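/- **Setting.** Let $a=\mathrm{diag}(a_1,\dots,a_n)\in sl(n,\mathbb C)$ be non-zero, $b=p(a)$ for a polynomial $p$, and $j\ge 1$ an integer. Let $sl(n)_a=\{y\in sl(n,\mathbb C): [a,y]=0\}$, let $sl(n)_a^\perp$ be its orthogonal complement in $sl(n,\mathbb C)$ for the form $\mathrm{tr}(yz)$, and let $\Gamma_a=\{\lambda\in\mathbb C:\ \mathrm{Re}(\lambda(a_i-a_k))=0\text{ for some } a_i\ne a_k\}$. For smooth $u$ with values in $sl(n)_a^\perp$, the polynomial differential operators $Q_{a,k}(u)$ are the ones determined by $Q_{a,0}=a$, $(Q_{a,k})_x+[u,Q_{a,k}]=[Q_{a,k+1},a]$ and $f\big(\sum_k Q_{a,k}\lambda^{-k}\big)=0$, where $f$ is the minimal polynomial of $a$; and $\sum_k Q_{b,k}(u)\lambda^{-k}=p\big(\sum_kQ_{a,k}(u)\lambda^{-k}\big)$. The $j$-th flow is $u_t=(Q_{b,j}(u))_x+[u,Q_{b,j}(u)]$. A trivialization of a solution $u:\mathcal O\to sl(n)_a^\perp$ on an open set $\mathcal O\ni(0,0)$ of $\mathbb R^2$ is a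 smooth $E:\mathcal O\times\mathbb C\to GL(n,\mathbb C)$ with $$E_x=E(a\lambda+u),\qquad E_t=E\big(b\lambda^j+Q_{b,1}(u)\lambda^{j-1}+\cdots+Q_{b,j}(u)\big),\qquad E(0,0,\lambda)=I .$$ Let $W\cup\{\infty\}$ ($W\subset\mathbb C$) be an open neighborhood of $\infty$ in the Riemann sphere. A local reduced wave function of $u$ (with trivialization $E$) on $W$ is a map $m(x,t,\lambda)$, meromorphic in $\lambda\in W\setminus\Gamma_a$ and, off a bounded set $S$ of exceptional points without accumulation point in $W\setminus\Gamma_a$, smooth in $(x,t,\lambda)$, holomorphic in $\lambda$ and $GL(n,\mathbb C)$-valued, such that $m\sim I+m_1(x,t)\lambda^{-1}+m_2(x,t)\lambda^{-2}+\cdots$ as $\lambda\to\infty$ in $\mathbb C\setminus\Gamma_a$, with smooth coefficients and locally uniformly in $(x,t)$, $u=[a,m_1]$, $E$ is entire in $\lambda$, and $E(x,t,\lambda)=m(0,0,\lambda)^{-1}e^{a\lambda x+b\lambda^jt}m(x,t,\lambda)$ for $\lambda\in W\setminus(\Gamma_a\cup S)$. For $\alpha_1,\alpha_2\in\mathbb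 C$ and a projection $\pi$ of $\mathbb C^n$ ($\pi^2=\pi$), the simple element is $$h_{\alpha_1,\alpha_2,\pi}(\lambda)=I+\frac{\alpha_1-\alpha_2}{\lambda-\alpha_1}(I-\pi).$$ **Theorem.** Let $u:\mathcal O_1\to sl(n)_a^\perp$ be a smooth solution of the $j$-th flow on an open set $\mathcal O_1\ni(0,0)$, $E$ its trivialization, $m$ a local reduced wave function of $u$ on $W$ with exceptional set $S$, and $h_{\alpha_1,\alpha_2,\pi}$ a simple element. Put $V_1=\mathrm{Im}\,\pi$, $V_2=\mathrm{Im}(I-\pi)$ and $\tilde V_i(x,t)=E(x,t,\alpha_i)^{-1}(V_i)$. Then there is a connected open $\mathcal O$ with $(0,0)\in\mathcal O\subset\mathcal O_1$ and $\tilde V_1(x,t)\cap\tilde V_2(x,t)=0$ for all $(x,t)\in\mathcal O$. Moreover, for every open $\mathcal O$ with $(0,0)\in\mathcal O\subset\mathcal O_1$ on which $\tilde V_1\cap\tilde V_2=0$, one has $\mathbb C^n=\tilde V_1(x,t)\oplus\tilde V_2(x,t)$ on $\mathcal O$, and the projection $\tilde\pi(x,t)$ onto $\tilde V_1(x,t)$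 along $\tilde V_2(x,t)$ is smooth on $\mathcal O$ and satisfies: (i) $\tilde u=u+(\alpha_1-\alpha_2)[a,\tilde\pi]$ is a smooth solution $\mathcal O\to sl(n)_a^\perp$ of the $j$-th flow. The function $\tilde E(x,t,\lambda)=h_{\alpha_1,\alpha_2,\pi}(\lambda)E(x,t,\lambda)h_{\alpha_1,\alpha_2,\tilde\pi(x,t)}(\lambda)^{-1}$ ($\lambda\neq\alpha_1,\alpha_2$) extends to all $\lambda\in\mathbb C$ as a trivialization of $\tilde u$, entire in $\lambda$, and $\tilde m(x,t,\lambda)=m(x,t,\lambda)h_{\alpha_1,\alpha_2,\tilde\pi(x,t)}(\lambda)^{-1}$ is a local reduced wave function of $\tilde u$ on $W$ (with trivialization $\tilde E$ and exceptional set $S\cup\{\alpha_1,\alpha_2\}$). (ii) $\tilde\pi$ is a solution on $\mathcal O$, and if $\mathcal O$ is connected the only one, of $$\begin{cases}\tilde\pi_x=-[u,\tilde\pi]-[a,\tilde\pi]\,(\alpha_2+(\alpha_1-\alpha_2)\tilde\pi),\\ \tilde\pi_t=-\sum_{k=0}^j[Q_{b,j-k}(u),\tilde\pi]\,(\alpha_2+(\alpha_1-\alpha_2)\tilde\pi)^k,\\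 \tilde\pi^2=\tilde\pi,\qquad \tilde\pi(0,0)=\pi.\end{cases}$$ -/

import Mathlib

open scoped ContDiff

noncomputable section

/-- Space-time points `(x, t)` are elements of `ℝ × ℝ`; matrices are `n × n` over `ℂ`. -/
abbrev Mat (n : ℕ) : Type := Matrix (Fin n) (Fin n) ℂ

/-- `∂f/∂x` at `z = (x, t)`, entrywise. -/
def partialX {n : ℕ} (f : ℝ × ℝ → Mat n) (z : ℝ × ℝ) : Mat n :=
  Matrix.of fun i k => deriv (fun s : ℝ => f (s, z.2) i k) z.1

/-- `∂f/∂x` exists at `z = (x, t)` and equals `D`, entrywise. -/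
def HasPartialX {n : ℕ} (f : ℝ × ℝ → Mat n) (D : Mat n) (z : ℝ × ℝ) : Prop :=
  ∀ i k, HasDerivAt (fun s : ℝ => f (s, z.2) i k) (D i k) z.1

/-- `∂f/∂t` exists at `z = (x, t)` and equals `D`, entrywise. -/
def HasPartialT {n : ℕ} (f : ℝ × ℝ → Mat n) (D : Mat n) (z : ℝ × ℝ) : Prop :=
  ∀ i k, HasDerivAt (fun s : ℝ => f (z.1, s) i k) (D i k) z.2

/-- Smoothness (`C^∞`) on `O`, entrywise. -/
def SmoothOn {n : ℕ} {X : Type*} [NormedAddCommGroup X] [NormedSpace ℝ X]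
    (f : X → Mat n) (O : Set X) : Prop :=
  ∀ i k, ContDiffOn ℝ ∞ (fun z => f z i k) O

/-- `sl(n)_a`, the centralizer of `a = diag(a_1, …, a_n)` in `sl(n, ℂ)`. -/
def slCentralizer {n : ℕ} (a : Fin n → ℂ) : Set (Mat n) :=
  {y | y.trace = 0 ∧ ⁅Matrix.diagonal a, y⁆ = 0}

/-- `sl(n)_a^⊥`, the orthogonal complement of `sl(n)_a` in `sl(n, ℂ)` for the form `tr(yz)`. -/
def slPerp {n : ℕ} (a : Fin n → ℂ) : Set (Mat n) :=
  {y | y.trace = 0 ∧ ∀ w ∈ slCentralizer a, (w * y).trace = 0}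

/-- The rays `Γ_a`: all `l` with `Re (l (a_i - a_k)) = 0` for some pair `a_i ≠ a_k`. -/
def scatteringRays {n : ℕ} (a : Fin n → ℂ) : Set ℂ :=
  {l | ∃ i k, a i ≠ a k ∧ (l * (a i - a k)).re = 0}

/-! ### The differential operators `Q_{b,k}(u)` for `b = p(a)` -/

/-- `f(X) = ∏ (X - c)` over the distinct eigenvalues `c` of `a`: the minimal polynomial of `a`. -/
def eigenPoly {n : ℕ} (a : Fin n → ℂ) : Polynomial ℂ :=
  ∏ c ∈ Finset.univ.image a, (Polynomial.X - Polynomial.C c)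

/-- Given the truncation `q = Q_0 + Q_1 X + ⋯ + Q_k X^k` of the series
`∑ Q_{a,i} X^i` (with `X = λ⁻¹`), the next coefficient `Q_{a,k+1}`.
Its entries with `a_i ≠ a_l` are determined by
`(Q_k)_x + [u, Q_k] = [Q_{k+1}, a]`; its entries with `a_i = a_l` are determined by the vanishing
of the coefficient of `X^{k+1}` in `f(∑ Q_i X^i)`, in which the contribution of `Q_{k+1}`
is `f'(a_i) (Q_{k+1})_{il}`. -/
def nextQ {n : ℕ} (a : Fin n → ℂ) (u : ℝ × ℝ → Mat n) (q : ℝ × ℝ → PowerSeries (Mat n))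
    (k : ℕ) (z : ℝ × ℝ) : Mat n :=
  Matrix.of fun i l =>
    if a i = a l then
      -(PowerSeries.coeff (k + 1) (Polynomial.aeval (q z) (eigenPoly a)) i l)
        / (eigenPoly a).derivative.eval (a i)
    else
      (partialX (fun w => PowerSeries.coeff k (q w)) z + ⁅u z, PowerSeries.coeff k (q z)⁆) i l
        / (a l - a i)

/-- The truncation `∑_{i ≤ k} Q_{a,i}(u) X^i`, starting from `Q_{a,0} = a`. -/
def truncQ {n : ℕ} (a : Fin n → ℂ) (u : ℝ × ℝ → Mat n) : ℕ → ℝ × ℝ → PowerSeries (Mat n)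
  | 0 => fun _ => PowerSeries.C (Matrix.diagonal a)
  | k + 1 => fun z =>
      truncQ a u k z + PowerSeries.monomial (k + 1) (nextQ a u (truncQ a u k) k z)

/-- `Q_{a,k}(u)`. -/
def Qa {n : ℕ} (a : Fin n → ℂ) (u : ℝ × ℝ → Mat n) (k : ℕ) (z : ℝ × ℝ) : Mat n :=
  PowerSeries.coeff k (truncQ a u k z)

/-- `Q_{b,k}(u)` for `b = p(a)`: the coefficient of `X^k` in `p(∑ Q_{a,i}(u) X^i)`. -/
def Qb {n : ℕ} (a : Fin n → ℂ) (p : Polynomial ℂ) (u : ℝ × ℝ → Mat n) (k : ℕ) (z : ℝ × ℝ) :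
    Mat n :=
  PowerSeries.coeff k (Polynomial.aeval (PowerSeries.mk fun i => Qa a u i z) p)

/-! ### Solutions, trivializations, reduced wave functions -/

/-- `u : O → sl(n)_a^⊥` is a (smooth) solution of the `j`-th flow
`u_t = (Q_{b,j}(u))_x + [u, Q_{b,j}(u)]`, where `b = p(a)`. -/
structure IsLocalSolution {n : ℕ} (a : Fin n → ℂ) (p : Polynomial ℂ) (j : ℕ) (O : Set (ℝ × ℝ))
    (u : ℝ × ℝ → Mat n) : Prop where
  smooth : SmoothOn u O
  mem_perp : ∀ z ∈ O, u z ∈ slPerp a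
  flow : ∀ z ∈ O, HasPartialT u (partialX (Qb a p u j) z + ⁅u z, Qb a p u j z⁆) z

/-- `E : O × ℂ → GL(n, ℂ)` is a trivialization of `u` normalized at `(0, 0)`:
`E_x = E (a l + u)`, `E_t = E (b l^j + Q_{b,1}(u) l^{j-1} + ⋯ + Q_{b,j}(u))`, `E(0,0,l) = I`
(note `Q_{b,0}(u) = b`). -/
structure IsTrivialization {n : ℕ} (a : Fin n → ℂ) (p : Polynomial ℂ) (j : ℕ) (O : Set (ℝ × ℝ))
    (u : ℝ × ℝ → Mat n) (E : ℝ × ℝ → ℂ → Mat n) : Prop where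
  smooth : SmoothOn (fun q : (ℝ × ℝ) × ℂ => E q.1 q.2) (O ×ˢ Set.univ)
  invertible : ∀ z ∈ O, ∀ l, IsUnit (E z l)
  eq_x : ∀ z ∈ O, ∀ l,
    HasPartialX (fun w => E w l) (E z l * (l • Matrix.diagonal a + u z)) z
  eq_t : ∀ z ∈ O, ∀ l,
    HasPartialT (fun w => E w l)
      (E z l * (l ^ j • Polynomial.aeval (Matrix.diagonal a) p
        + ∑ k ∈ Finset.Icc 1 j, l ^ (j - k) • Qb a p u k z)) z
  normalized : ∀ l, E (0, 0) l = 1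

/-- `m(z, l) ∼ ∑ c_k(z) l^{-k}` as `l → ∞` in `ℂ \ Γ`, locally uniformly in `z ∈ O`. -/
def HasExpansionAtInfty {n : ℕ} (O : Set (ℝ × ℝ)) (Γ : Set ℂ) (m : ℝ × ℝ → ℂ → Mat n)
    (c : ℕ → ℝ × ℝ → Mat n) : Prop :=
  ∀ N : ℕ, ∀ K ⊆ O, IsCompact K → ∃ C R : ℝ, ∀ z ∈ K, ∀ l ∉ Γ, R ≤ ‖l‖ → ∀ i k,
    ‖(m z l - ∑ r ∈ Finset.range (N + 1), (l ^ r)⁻¹ • c r z) i k‖ ≤ C * (‖l‖ ^ (N + 1))⁻¹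

/-- `m` is a local reduced wave function of the local solution `u` with trivialization `E`.
`W ∪ {∞}` is an open neighborhood of `∞` in the Riemann sphere on which `m` lives
(`W = ℂ` is allowed); `S` is the set of exceptional points, where `m(z, ·)` may have a pole or a
singular value. -/
structure IsReducedWaveFunction {n : ℕ} (a : Fin n → ℂ) (p : Polynomial ℂ) (j : ℕ)
    (O : Set (ℝ × ℝ)) (W S : Set ℂ) (u : ℝ × ℝ → Mat n) (E m : ℝ × ℝ → ℂ → Mat n) : Prop where
  isOpen_domain : IsOpen W
  domain_nhds_infty : Bornology.IsBounded Wᶜ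
  exceptional_bounded : Bornology.IsBounded S
  exceptional_discrete : Sᶜ ∈ Filter.codiscreteWithin (W \ scatteringRays a)
  smooth : SmoothOn (fun q : (ℝ × ℝ) × ℂ => m q.1 q.2) (O ×ˢ ((W \ scatteringRays a) \ S))
  invertible : ∀ z ∈ O, ∀ l ∈ (W \ scatteringRays a) \ S, IsUnit (m z l)
  holomorphic : ∀ z ∈ O, ∀ i k,
    DifferentiableOn ℂ (fun l => m z l i k) ((W \ scatteringRays a) \ S)
  meromorphic : ∀ z ∈ O, ∀ i k, MeromorphicOn (fun l => m z l i k) (W \ scatteringRays a)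
  expansion : ∃ c : ℕ → ℝ × ℝ → Mat n,
    (∀ r, SmoothOn (c r) O) ∧ (∀ z ∈ O, c 0 z = 1) ∧
    HasExpansionAtInfty O (scatteringRays a) m c ∧
    ∀ z ∈ O, u z = ⁅Matrix.diagonal a, c 1 z⁆
  entire : ∀ z ∈ O, ∀ i k, Differentiable ℂ (fun l => E z l i k)
  wave_eq : ∀ z ∈ O, ∀ l ∈ (W \ scatteringRays a) \ S,
    E z l = (m (0, 0) l)⁻¹
      * NormedSpace.exp ((l * (z.1 : ℂ)) • Matrix.diagonal a
          + (l ^ j * (z.2 : ℂ)) • Polynomial.aeval (Matrix.diagonal a) p)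
      * m z l

/-! ### Simple elements and the transformed projection -/

/-- The simple element `h_{α₁,α₂,π}(l) = I + (α₁ - α₂)/(l - α₁) (I - π)`. -/
def simpleElement {n : ℕ} (α₁ α₂ : ℂ) (π : Mat n) (l : ℂ) : Mat n :=
  1 + ((α₁ - α₂) / (l - α₁)) • (1 - π)

/-- `A⁻¹(Im P)`, as a preimage. -/
def pullbackRange {n : ℕ} (A P : Mat n) : Submodule ℂ (Fin n → ℂ) :=
  (LinearMap.range (Matrix.toLin' P)).comap (Matrix.toLin' A)

open Classical in
/-- The matrix of the projection onto `V₁` along `V₂`, when `ℂⁿ = V₁ ⊕ V₂`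
(and `0` otherwise). -/
def projMatrix {n : ℕ} (V₁ V₂ : Submodule ℂ (Fin n → ℂ)) : Mat n :=
  if h : IsCompl V₁ V₂ then LinearMap.toMatrix' (V₁.projection V₂ h) else 0

/-- `π̃(z)`: the projection onto `Ṽ₁(z) = E(z,α₁)⁻¹(Im π)` along
`Ṽ₂(z) = E(z,α₂)⁻¹(Im (I - π))`. -/
def dressedProj {n : ℕ} (E : ℝ × ℝ → ℂ → Mat n) (α₁ α₂ : ℂ) (π : Mat n) (z : ℝ × ℝ) : Mat n :=
  projMatrix (pullbackRange (E z α₁) π) (pullbackRange (E z α₂) (1 - π))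

/-- The first-order system for the transformed projection `σ` on `O`. -/
structure SolvesProjSystem {n : ℕ} (a : Fin n → ℂ) (p : Polynomial ℂ) (j : ℕ) (O : Set (ℝ × ℝ))
    (u : ℝ × ℝ → Mat n) (α₁ α₂ : ℂ) (π : Mat n) (σ : ℝ × ℝ → Mat n) : Prop where
  eq_x : ∀ z ∈ O, HasPartialX σ
    (-⁅u z, σ z⁆ - ⁅Matrix.diagonal a, σ z⁆ * (α₂ • (1 : Mat n) + (α₁ - α₂) • σ z)) z
  eq_t : ∀ z ∈ O, HasPartialT σ
    (-∑ k ∈ Finset.range (j + 1),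
      ⁅Qb a p u (j - k) z, σ z⁆ * (α₂ • (1 : Mat n) + (α₁ - α₂) • σ z) ^ k) z
  idem : ∀ z ∈ O, σ z * σ z = σ z
  initial : σ (0, 0) = π

end

/-!
The transformed trivialization is `Ẽ = h E h̃⁻¹` with `h = h_{α₁,α₂,π}` and `h̃ = h_{α₁,α₂,π̃}`.
As `h̃⁻¹ = h_{α₂,α₁,π̃}`, its only possible poles are at `α₁` and `α₂`, with residues proportional
to `(1 - π) E(α₁) π̃` and `π E(α₂) (1 - π̃)`. These vanish precisely because `π̃` is the projection
onto `E(α₁)⁻¹(Im π)` along `E(α₂)⁻¹(Im (1 - π))`; differentiating the two relations gives the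
equations for `π̃`. The defect `(1 - π) E(α₁) ρ + π E(α₂) (1 - ρ)` of another solution `ρ` of these
equations satisfies linear equations and vanishes at the origin, whence uniqueness.

Up to a scalar factor `h̃` is `λ - τ` with `τ = α₂ + (α₁ - α₂) π̃`. The equation
`τ_x = -[u, τ] - [a, τ] τ` says that `λ - τ` transforms the connection `aλ + u` into `aλ + ũ`, so
`(λ - τ) Q (λ - τ)⁻¹`, expanded in `λ⁻¹`, satisfies the equations that determine the series
`∑ Q_{a,k}(ũ) λ⁻ᵏ`. Taking polynomial parts, the coefficient of `Ẽ_t` is that of the trivialization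
of `ũ`. The flow for `ũ` is then the equality of the mixed partial derivatives of `Ẽ` at `λ = 0`.
-/

section Division

open MeasureTheory Set
open scoped Convolution

theorem contDiffOn_setIntegral {H V : Type*} [NormedAddCommGroup H] [NormedSpace ℝ H]
    [NormedAddCommGroup V] [NormedSpace ℝ V] {U : Set H} (hU : IsOpen U) {K : Set ℝ}
    (hK : Bornology.IsBounded K) (hKm : MeasurableSet K) {F : H × ℝ → V}
    (hF : ContDiffOn ℝ ∞ F (U ×ˢ univ)) :
    ContDiffOn ℝ ∞ (fun y => ∫ s in K, F (y, s)) U := by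
  obtain ⟨r, hr, hKr⟩ := hK.subset_closedBall_lt 0 0
  let χ : ContDiffBump (0 : ℝ) := ⟨r, r + 1, hr, lt_add_one r⟩
  have hind : LocallyIntegrable ((-K).indicator fun _ => (1 : ℝ)) volume :=
    (locallyIntegrable_const 1).indicator hKm.neg
  -- The integral is the value at `0` of the convolution of `χ F(y, ·)` with the indicator of `-K`.
  refine (contDiffOn_convolution_left_with_param_comp (n := (⊤ : ℕ∞)) (μ := volume)
    (ContinuousLinearMap.lsmul ℝ ℝ).flip (v := fun _ => (0 : ℝ))
    (g := fun y s => χ s • F (y, s)) contDiffOn_const hU (isCompact_closedBall 0 (r + 1))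
    (fun y s _ hs => ?_) hind ?_).congr fun y _ => ?_
  · rw [χ.zero_of_le_dist (by simpa using hs : r + 1 < dist s 0).le, zero_smul]
  · exact (χ.contDiff.comp contDiff_snd).contDiffOn.smul hF
  · rw [convolution_def, ← integral_indicator hKm]
    congr 1 with s
    by_cases hs : s ∈ K
    · simp [hs, χ.one_of_mem_closedBall (hKr hs)]
    · simp [hs]

theorem differentiable_dslope {V : Type*} [NormedAddCommGroup V] [NormedSpace ℂ V]
    [CompleteSpace V] {f : ℂ → V} (hf : Differentiable ℂ f) (α : ℂ) :
    Differentiable ℂ (dslope f α) :=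
  differentiableOn_univ.mp
    ((Complex.differentiableOn_dslope Filter.univ_mem).mpr hf.differentiableOn)

variable {H V : Type*} [NormedAddCommGroup H] [NormedSpace ℝ H] [NormedAddCommGroup V]
  [NormedSpace ℝ V] [NormedSpace ℂ V] [IsScalarTower ℝ ℂ V]

theorem dslope_eq_setIntegral_deriv [CompleteSpace V] {f : ℂ → V} (hf : Differentiable ℂ f)
    (α l : ℂ) :
    dslope f α l = ∫ s in Icc (0 : ℝ) 1, deriv f (α + s * (l - α)) := by
  rcases eq_or_ne l α with rfl | hne
  · simp
  have hf' : Continuous (deriv f) :=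
    (hf.contDiff (n := 1)).continuous_deriv le_rfl
  have hderiv (s : ℝ) : HasDerivAt (fun s : ℝ => f (α + s * (l - α)))
      ((l - α) • deriv f (α + s * (l - α))) s := by
    have hline : HasDerivAt (fun s : ℝ => α + (s : ℂ) * (l - α)) (l - α) s := by
      simpa using ((Complex.ofRealCLM.hasDerivAt (x := s)).mul_const (l - α)).const_add α
    exact (hf _).hasDerivAt.scomp s hline
  have hint := intervalIntegral.integral_eq_sub_of_hasDerivAt (a := 0) (b := 1)
    (fun s _ => hderiv s) (Continuous.intervalIntegrable (by fun_prop) _ _)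
  rw [intervalIntegral.integral_smul, intervalIntegral.integral_of_le zero_le_one,
    ← integral_Icc_eq_integral_Ioc] at hint
  rw [dslope_of_ne _ hne, slope_def_module, inv_smul_eq_iff₀ (sub_ne_zero.mpr hne), hint]
  simp

theorem deriv_slice_eq_fderiv {F : H × ℂ → V} {y : H} {l : ℂ}
    (hF : DifferentiableAt ℝ F (y, l)) (hFl : DifferentiableAt ℂ (fun l => F (y, l)) l) :
    deriv (fun l => F (y, l)) l = fderiv ℝ F (y, l) (0, 1) := by
  have hslice := hF.hasFDerivAt.comp l (hasFDerivAt_prodMk_right y l)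
  have := congrArg (· 1) (hslice.unique (hFl.hasFDerivAt.restrictScalars ℝ))
  simpa using this.symm

theorem contDiffOn_dslope [CompleteSpace V] {O : Set H} (hO : IsOpen O) {F : H × ℂ → V}
    (hF : ContDiffOn ℝ ∞ F (O ×ˢ univ))
    (hFl : ∀ y ∈ O, Differentiable ℂ fun l => F (y, l)) (α : ℂ) :
    ContDiffOn ℝ ∞ (fun q : H × ℂ => dslope (fun l => F (q.1, l)) α q.2) (O ×ˢ univ) := by
  have hO' : IsOpen (O ×ˢ (univ : Set ℂ)) := hO.prod isOpen_univ
  have hF' : ContDiffOn ℝ ∞ (fun q => fderiv ℝ F q (0, 1)) (O ×ˢ univ) :=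
    (hF.fderiv_of_isOpen hO' (by simp)).clm_apply contDiffOn_const
  have hline : ContDiff ℝ ∞ fun q : (H × ℂ) × ℝ => (q.1.1, α + (q.2 : ℂ) * (q.1.2 - α)) := by
    have : ContDiff ℝ ∞ fun q : (H × ℂ) × ℝ => (q.2 : ℂ) :=
      Complex.ofRealCLM.contDiff.comp contDiff_snd
    fun_prop
  refine (contDiffOn_setIntegral hO' (Metric.isBounded_Icc 0 1) measurableSet_Icc
    (hF'.comp hline.contDiffOn fun q hq => ⟨hq.1.1, mem_univ _⟩)).congr ?_
  rintro ⟨y, l⟩ ⟨hy, -⟩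
  refine (dslope_eq_setIntegral_deriv (hFl y hy) α l).trans (integral_congr_ae (.of_forall ?_))
  exact fun s => deriv_slice_eq_fderiv
    ((hF.contDiffAt (hO'.mem_nhds (mk_mem_prod hy (mem_univ _)))).differentiableAt (by simp))
    (hFl y hy _)

end Division

section PartialDerivatives

open scoped Matrix.Norms.Operator

variable {n : ℕ}

theorem smoothOn_iff {X : Type*} [NormedAddCommGroup X] [NormedSpace ℝ X] {f : X → Mat n}
    {O : Set X} : SmoothOn f O ↔ ContDiffOn ℝ ∞ f O := by
  let e : (Fin n → Fin n → ℂ) ≃L[ℝ] Mat n := (Matrix.ofLinearEquiv ℝ).toContinuousLinearEquiv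
  rw [← e.symm.comp_contDiffOn_iff, contDiffOn_pi]
  exact forall_congr' fun _ => contDiffOn_pi.symm

theorem hasPartialX_iff {f : ℝ × ℝ → Mat n} {D : Mat n} {z : ℝ × ℝ} :
    HasPartialX f D z ↔ HasDerivAt (fun s => f (s, z.2)) D z.1 :=
  (forall_congr' fun _ => hasDerivAt_pi.symm).trans hasDerivAt_pi.symm

theorem hasPartialT_iff {f : ℝ × ℝ → Mat n} {D : Mat n} {z : ℝ × ℝ} :
    HasPartialT f D z ↔ HasDerivAt (fun s => f (z.1, s)) D z.2 :=
  (forall_congr' fun _ => hasDerivAt_pi.symm).trans hasDerivAt_pi.symm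

theorem HasPartialX.partialX_eq {f : ℝ × ℝ → Mat n} {D : Mat n} {z : ℝ × ℝ}
    (h : HasPartialX f D z) : partialX f z = D :=
  Matrix.ext fun i k => (h i k).deriv

theorem differentiable_matrix_iff {f : ℂ → Mat n} :
    Differentiable ℂ f ↔ ∀ i k, Differentiable ℂ fun l => f l i k :=
  (differentiable_pi (𝕜 := ℂ) (Φ := f)).trans (forall_congr' fun _ => differentiable_pi)

theorem contDiffOn_ringInverse {X 𝔸 : Type*} [NormedAddCommGroup X] [NormedSpace ℝ X]
    [NormedRing 𝔸] [NormedAlgebra ℝ 𝔸] [HasSummableGeomSeries 𝔸] {f : X → 𝔸} {O : Set X}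
    (hf : ContDiffOn ℝ ∞ f O) (hu : ∀ x ∈ O, IsUnit (f x)) :
    ContDiffOn ℝ ∞ (fun x => Ring.inverse (f x)) O := fun x hx => by
  have hinv := contDiffAt_ringInverse ℝ (n := ∞) (hu x hx).unit
  exact hinv.comp_contDiffWithinAt x (hf x hx)

variable {V : Type*} [NormedAddCommGroup V] [NormedSpace ℝ V] {O : Set (ℝ × ℝ)} {F : ℝ × ℝ → V}
  {z : ℝ × ℝ}

theorem hasDerivAt_slice_fst (hF : DifferentiableAt ℝ F z) :
    HasDerivAt (fun s => F (s, z.2)) (fderiv ℝ F z (1, 0)) z.1 :=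
  hF.hasFDerivAt.comp_hasDerivAt z.1 ((hasDerivAt_id _).prodMk (hasDerivAt_const _ _))

theorem hasDerivAt_slice_snd (hF : DifferentiableAt ℝ F z) :
    HasDerivAt (fun s => F (z.1, s)) (fderiv ℝ F z (0, 1)) z.2 :=
  hF.hasFDerivAt.comp_hasDerivAt z.2 ((hasDerivAt_const _ _).prodMk (hasDerivAt_id _))

theorem contDiffOn_partialX {f : ℝ × ℝ → Mat n} (hO : IsOpen O) (hf : ContDiffOn ℝ ∞ f O) :
    ContDiffOn ℝ ∞ (partialX f) O := by
  refine ((hf.fderiv_of_isOpen hO (by simp)).clm_apply contDiffOn_const).congr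
    (f₁ := partialX f) (f := fun z => fderiv ℝ f z (1, 0)) fun z hz => ?_
  exact (hasPartialX_iff.mpr (hasDerivAt_slice_fst
    ((hf.contDiffAt (hO.mem_nhds hz)).differentiableAt (by simp)))).partialX_eq

end PartialDerivatives

section TwistedDerivations

open PowerSeries

/-- `δ` is a derivation of `K[X]` with values in `A`, where `X` acts on the left through `S` and on
the right through `T`. Both `f ↦ f(T) - f(S)` and, for a derivation `D`, `f ↦ D (f(S))` are of this
kind; this reduces statements about `f(S)` to statements about `δ X`. -/
structure IsTwistedDerivation {K A : Type*} [CommRing K] [Ring A] [Algebra K A] (S T : A)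
    (δ : Polynomial K → A) : Prop where
  map_add : ∀ f g, δ (f + g) = δ f + δ g
  map_C : ∀ c, δ (.C c) = 0
  map_mul_X : ∀ f, δ (f * .X) = δ f * T + Polynomial.aeval S f * δ .X

theorem isTwistedDerivation_aeval_sub {K A : Type*} [CommRing K] [Ring A] [Algebra K A]
    (S T : A) :
    IsTwistedDerivation (K := K) S T fun f => Polynomial.aeval T f - Polynomial.aeval S f where
  map_add f g := by simp only [map_add]; abel
  map_C c := by simp
  map_mul_X f := by
    simp only [map_mul, Polynomial.aeval_X]
    noncomm_ring

theorem constantCoeff_aeval {K A : Type*} [CommRing K] [Ring A] [Algebra K A] (S : A⟦X⟧)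
    (f : Polynomial K) :
    constantCoeff (Polynomial.aeval S f) = Polynomial.aeval (constantCoeff S) f :=
  (Polynomial.hom_eval₂ f _ constantCoeff S).trans (by congr 1)

theorem aeval_diagonal {K ι : Type*} [CommRing K] [Fintype ι] [DecidableEq ι] (a : ι → K)
    (f : Polynomial K) :
    Polynomial.aeval (Matrix.diagonal a) f = Matrix.diagonal fun i => f.eval (a i) := by
  have h := Polynomial.aeval_algHom_apply (Matrix.diagonalAlgHom (n := ι) (α := K) K) a f
  rwa [Polynomial.aeval_pi_apply] at h

theorem X_pow_succ_dvd_iff {A : Type*} [Ring A] {m : ℕ} {φ : A⟦X⟧} :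
    X ^ (m + 1) ∣ φ ↔ X ^ m ∣ φ ∧ coeff m φ = 0 := by
  simp only [X_pow_dvd_iff, Nat.forall_lt_succ_right]

theorem coeff_mul_of_X_pow_dvd_left {A : Type*} [Ring A] {m : ℕ} {φ : A⟦X⟧} (h : X ^ m ∣ φ)
    (ψ : A⟦X⟧) : coeff m (φ * ψ) = coeff m φ * constantCoeff ψ := by
  obtain ⟨χ, rfl⟩ := h
  simp [mul_assoc, coeff_X_pow_mul']

theorem coeff_mul_of_X_pow_dvd_right {A : Type*} [Ring A] {m : ℕ} {ψ : A⟦X⟧} (h : X ^ m ∣ ψ)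
    (φ : A⟦X⟧) : coeff m (φ * ψ) = constantCoeff φ * coeff m ψ := by
  obtain ⟨χ, rfl⟩ := h
  rw [X_pow_mul, ← mul_assoc]
  simp [coeff_mul_X_pow']

namespace IsTwistedDerivation

theorem X_pow_dvd {K A : Type*} [CommRing K] [Ring A] [Algebra K A] {S T : A⟦X⟧}
    {δ : Polynomial K → A⟦X⟧} (hδ : IsTwistedDerivation S T δ) {m : ℕ} (hm : X ^ m ∣ δ .X)
    (f : Polynomial K) : X ^ m ∣ δ f := by
  have hmul_X (f : Polynomial K) (hf : X ^ m ∣ δ f) : X ^ m ∣ δ (f * .X) := by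
    obtain ⟨χ, hχ⟩ := hm
    rw [hδ.map_mul_X, hχ, ← mul_assoc, ← X_pow_mul, mul_assoc]
    exact dvd_add (hf.mul_right _) (dvd_mul_right _ _)
  induction f using Polynomial.induction_on with
  | C c => simp only [hδ.map_C, dvd_zero]
  | add f g hf hg => exact hδ.map_add f g ▸ dvd_add hf hg
  | monomial k c h => simpa only [pow_succ, mul_assoc] using hmul_X _ h

theorem coeff_apply {K ι : Type*} [CommRing K] [Fintype ι] [DecidableEq ι] {a : ι → K}
    {S T : (Matrix ι ι K)⟦X⟧} {δ : Polynomial K → (Matrix ι ι K)⟦X⟧}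
    (hδ : IsTwistedDerivation S T δ) (hS : constantCoeff S = Matrix.diagonal a)
    (hT : constantCoeff T = Matrix.diagonal a) {m : ℕ} (hm : X ^ m ∣ δ .X) {i l : ι}
    (hil : a i = a l) (f : Polynomial K) :
    coeff m (δ f) i l = f.derivative.eval (a i) * coeff m (δ .X) i l := by
  have hmul_X (f : Polynomial K)
      (hf : coeff m (δ f) i l = f.derivative.eval (a i) * coeff m (δ .X) i l) :
      coeff m (δ (f * .X)) i l = (f * .X).derivative.eval (a i) * coeff m (δ .X) i l := by
    have hcoeff : coeff m (δ (f * .X)) = coeff m (δ f) * Matrix.diagonal a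
        + (Matrix.diagonal fun i => f.eval (a i)) * coeff m (δ .X) := by
      rw [hδ.map_mul_X, _root_.map_add, coeff_mul_of_X_pow_dvd_left (hδ.X_pow_dvd hm f),
        coeff_mul_of_X_pow_dvd_right hm, constantCoeff_aeval, hS, hT, aeval_diagonal]
    rw [hcoeff, Matrix.add_apply, Matrix.mul_diagonal, Matrix.diagonal_mul, hf, ← hil]
    simp only [Polynomial.derivative_mul, Polynomial.derivative_X, Polynomial.eval_add,
      Polynomial.eval_mul, Polynomial.eval_X, mul_one]
    ring
  induction f using Polynomial.induction_on with
  | C c => simp [hδ.map_C]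
  | add f g hf hg => simp [hδ.map_add, hf, hg, add_mul]
  | monomial k c h => simpa only [pow_succ, mul_assoc] using hmul_X _ h

end IsTwistedDerivation

end TwistedDerivations

section CovariantDerivative

open PowerSeries Filter
open scoped Topology

variable {𝔸 : Type*} [NormedRing 𝔸] [NormedAlgebra ℝ 𝔸]

/-- Coefficientwise differentiability of a curve of power series at `s`. -/
def CoeffDifferentiableAt (F : ℝ → 𝔸⟦X⟧) (s : ℝ) : Prop :=
  ∀ k, DifferentiableAt ℝ (fun r => coeff k (F r)) s

/-- Coefficientwise derivative of a curve of power series. -/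
noncomputable def coeffDeriv (F : ℝ → 𝔸⟦X⟧) (s : ℝ) : 𝔸⟦X⟧ :=
  mk fun k => deriv (fun r => coeff k (F r)) s

/-- The covariant derivative `X F' + P F - F Q` of a section `F` of the homomorphisms between two
bundles with connection forms `Q` and `P`. Here `X = λ⁻¹`, and the connection `∂ + aλ + u` becomes
`P = a + u X` after multiplication by `X`. -/
noncomputable def covDeriv (P Q : 𝔸⟦X⟧) (F : ℝ → 𝔸⟦X⟧) (s : ℝ) : 𝔸⟦X⟧ :=
  X * coeffDeriv F s + P * F s - F s * Q

namespace CoeffDifferentiableAt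

variable {F G : ℝ → 𝔸⟦X⟧} {s : ℝ}

theorem const (c : 𝔸⟦X⟧) : CoeffDifferentiableAt (fun _ => c) s :=
  fun _ => differentiableAt_const _

theorem add (hF : CoeffDifferentiableAt F s) (hG : CoeffDifferentiableAt G s) :
    CoeffDifferentiableAt (fun r => F r + G r) s := fun k => by
  simpa only [map_add] using (hF k).fun_add (hG k)

theorem sub (hF : CoeffDifferentiableAt F s) (hG : CoeffDifferentiableAt G s) :
    CoeffDifferentiableAt (fun r => F r - G r) s := fun k => by
  simpa only [map_sub] using (hF k).fun_sub (hG k)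

theorem mul (hF : CoeffDifferentiableAt F s) (hG : CoeffDifferentiableAt G s) :
    CoeffDifferentiableAt (fun r => F r * G r) s := fun k => by
  simp only [coeff_mul]
  exact .fun_sum fun x _ => (hF x.1).mul (hG x.2)

theorem aeval {K : Type*} [CommRing K] [Algebra K 𝔸] (hF : CoeffDifferentiableAt F s)
    (f : Polynomial K) : CoeffDifferentiableAt (fun r => Polynomial.aeval (F r) f) s := by
  induction f using Polynomial.induction_on with
  | C c => simpa only [Polynomial.aeval_C] using const _
  | add f g hf hg => simpa only [map_add] using hf.add hg
  | monomial k c h =>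
    simpa only [map_mul, map_pow, Polynomial.aeval_X, pow_succ, mul_assoc] using h.mul hF

end CoeffDifferentiableAt

variable {F G : ℝ → 𝔸⟦X⟧} {s : ℝ}

theorem coeffDeriv_mul (hF : CoeffDifferentiableAt F s) (hG : CoeffDifferentiableAt G s) :
    coeffDeriv (fun r => F r * G r) s = coeffDeriv F s * G s + F s * coeffDeriv G s := by
  ext k
  have h : HasDerivAt (fun r => coeff k (F r * G r)) (∑ x ∈ Finset.HasAntidiagonal.antidiagonal k,
      (coeff x.1 (coeffDeriv F s) * coeff x.2 (G s)
        + coeff x.1 (F s) * coeff x.2 (coeffDeriv G s))) s := by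
    simp only [coeff_mul, coeffDeriv, coeff_mk]
    exact .fun_sum fun x _ => (hF x.1).hasDerivAt.mul (hG x.2).hasDerivAt
  rw [coeffDeriv, coeff_mk, h.deriv, Finset.sum_add_distrib, map_add, coeff_mul, coeff_mul]

theorem covDeriv_add (P Q : 𝔸⟦X⟧) (hF : CoeffDifferentiableAt F s)
    (hG : CoeffDifferentiableAt G s) :
    covDeriv P Q (fun r => F r + G r) s = covDeriv P Q F s + covDeriv P Q G s := by
  have h : coeffDeriv (fun r => F r + G r) s = coeffDeriv F s + coeffDeriv G s := by
    ext k
    simpa only [coeffDeriv, coeff_mk, map_add] using deriv_fun_add (hF k) (hG k)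
  rw [covDeriv, h, covDeriv, covDeriv]
  noncomm_ring

theorem covDeriv_mul (P Q R : 𝔸⟦X⟧) (hF : CoeffDifferentiableAt F s)
    (hG : CoeffDifferentiableAt G s) :
    covDeriv P R (fun r => F r * G r) s = covDeriv P Q F s * G s + F s * covDeriv Q R G s := by
  rw [covDeriv, coeffDeriv_mul hF hG, covDeriv, covDeriv]
  simp only [mul_add, mul_sub, add_mul, sub_mul, ← mul_assoc, (commute_X (F s)).eq]
  abel

theorem isTwistedDerivation_covDeriv {K : Type*} [CommRing K] [Algebra K 𝔸] (P : 𝔸⟦X⟧)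
    (hF : CoeffDifferentiableAt F s) :
    IsTwistedDerivation (K := K) (F s) (F s)
      fun f => covDeriv P P (fun r => Polynomial.aeval (F r) f) s where
  map_add f g := by
    simp only [map_add]
    exact covDeriv_add P P (hF.aeval f) (hF.aeval g)
  map_C c := by
    have h : coeffDeriv (fun _ => algebraMap K 𝔸⟦X⟧ c) s = 0 := by
      ext k
      simp [coeffDeriv]
    simp only [Polynomial.aeval_C, covDeriv, h, Algebra.commutes, mul_zero, zero_add, sub_self]
  map_mul_X f := by
    simp only [map_mul, Polynomial.aeval_X]
    exact covDeriv_mul P P P (hF.aeval f) hF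

theorem coeff_covDeriv_of_X_pow_dvd {m : ℕ} (P Q : 𝔸⟦X⟧) (h : ∀ᶠ r in 𝓝 s, X ^ m ∣ F r) :
    coeff m (covDeriv P Q F s)
      = constantCoeff P * coeff m (F s) - coeff m (F s) * constantCoeff Q := by
  have hX : coeff m (X * coeffDeriv F s) = 0 := by
    cases m with
    | zero => exact coeff_zero_X_mul _
    | succ k =>
      have hzero : (fun r => coeff k (F r)) =ᶠ[𝓝 s] fun _ => 0 :=
        h.mono fun r hr => X_pow_dvd_iff.mp hr k k.lt_succ_self
      rw [coeff_succ_X_mul, coeffDeriv, coeff_mk, hzero.deriv_eq, deriv_const]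
  rw [covDeriv, map_sub, map_add, hX, zero_add, coeff_mul_of_X_pow_dvd_right h.self_of_nhds,
    coeff_mul_of_X_pow_dvd_left h.self_of_nhds]

theorem coeff_succ_covDeriv_C_add_C_mul_X (A U : 𝔸) (k : ℕ) :
    coeff (k + 1) (covDeriv (C A + C U * X) (C A + C U * X) F s)
      = deriv (fun r => coeff k (F r)) s + ⁅A, coeff (k + 1) (F s)⁆ + ⁅U, coeff k (F s)⁆ := by
  have hcomm : C U * X * F s = C U * F s * X := by rw [mul_assoc, X_mul, mul_assoc]
  simp only [covDeriv, coeffDeriv, Ring.lie_def, add_mul, mul_add, hcomm, ← mul_assoc, map_sub,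
    map_add, coeff_succ_mul_X, coeff_succ_X_mul, coeff_C_mul, coeff_mul_C, coeff_mk]
  abel

end CovariantDerivative

section Recursion

open PowerSeries Filter
open scoped Topology Matrix.Norms.Operator

variable {n : ℕ}

theorem eval_eigenPoly (a : Fin n → ℂ) (i : Fin n) : (eigenPoly a).eval (a i) = 0 := by
  rw [eigenPoly, Polynomial.eval_prod]
  exact Finset.prod_eq_zero (Finset.mem_image_of_mem a (Finset.mem_univ i)) (by simp)

theorem eval_derivative_eigenPoly_ne_zero (a : Fin n → ℂ) (i : Fin n) :
    (eigenPoly a).derivative.eval (a i) ≠ 0 := by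
  have hsep : (eigenPoly a).Separable :=
    Polynomial.separable_prod_X_sub_C_iff'.mpr fun _ _ _ _ => id
  exact hsep.eval₂_derivative_ne_zero (RingHom.id ℂ) (eval_eigenPoly a i)

theorem lie_diagonal_apply (a : Fin n → ℂ) (B : Mat n) (i l : Fin n) :
    ⁅Matrix.diagonal a, B⁆ i l = (a i - a l) * B i l := by
  rw [Ring.lie_def, Matrix.sub_apply, Matrix.diagonal_mul, Matrix.mul_diagonal]
  ring

theorem eventually_mem_slice_fst {O : Set (ℝ × ℝ)} (hO : IsOpen O) {z : ℝ × ℝ} (hz : z ∈ O) :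
    ∀ᶠ s in 𝓝 z.1, (s, z.2) ∈ O :=
  (Continuous.prodMk_left z.2).continuousAt.eventually_mem (hO.mem_nhds hz)

theorem eventually_mem_slice_snd {O : Set (ℝ × ℝ)} (hO : IsOpen O) {z : ℝ × ℝ} (hz : z ∈ O) :
    ∀ᶠ s in 𝓝 z.2, (z.1, s) ∈ O :=
  (Continuous.prodMk_right z.1).continuousAt.eventually_mem (hO.mem_nhds hz)

/-- `∑ Q_{a,k}(u) X^k`. -/
noncomputable def qaSeries (a : Fin n → ℂ) (u : ℝ × ℝ → Mat n) (z : ℝ × ℝ) : (Mat n)⟦X⟧ :=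
  mk fun k => Qa a u k z

/-- The connection form `a + u X`, which is `X` times the coefficient `aλ + u` of the linear
system when `X = λ⁻¹`. -/
noncomputable def connectionSeries (a : Fin n → ℂ) (U : Mat n) : (Mat n)⟦X⟧ :=
  C (Matrix.diagonal a) + C U * X

/-- `q` satisfies on `O` the equations that determine the series `∑ Q_{a,k}(u) X^k`. -/
structure IsQSeries (a : Fin n → ℂ) (u : ℝ × ℝ → Mat n) (O : Set (ℝ × ℝ))
    (q : ℝ × ℝ → (Mat n)⟦X⟧) : Prop where
  constantCoeff_eq : ∀ z ∈ O, constantCoeff (q z) = Matrix.diagonal a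
  coeffDifferentiableAt : ∀ z ∈ O, CoeffDifferentiableAt (fun s => q (s, z.2)) z.1
  covDeriv_eq_zero : ∀ z ∈ O,
    covDeriv (connectionSeries a (u z)) (connectionSeries a (u z)) (fun s => q (s, z.2)) z.1 = 0
  aeval_eigenPoly : ∀ z ∈ O, Polynomial.aeval (q z) (eigenPoly a) = 0

theorem constantCoeff_connectionSeries (a : Fin n → ℂ) (U : Mat n) :
    constantCoeff (connectionSeries a U) = Matrix.diagonal a := by
  simp [connectionSeries]

theorem coeff_covDeriv_connectionSeries {F : ℝ → (Mat n)⟦X⟧} {s : ℝ} {m : ℕ} (a : Fin n → ℂ)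
    (U : Mat n) (h : ∀ᶠ r in 𝓝 s, X ^ m ∣ F r) :
    coeff m (covDeriv (connectionSeries a U) (connectionSeries a U) F s)
      = ⁅Matrix.diagonal a, coeff m (F s)⁆ := by
  rw [coeff_covDeriv_of_X_pow_dvd _ _ h, constantCoeff_connectionSeries, Ring.lie_def]

/-- Two series with the same equations agree: at the first order at which they differ, the
differential equation determines the entries of the difference with `a i ≠ a l`, and the
algebraic equation those with `a i = a l`, because `f'(a i) ≠ 0`. -/
theorem IsQSeries.eqOn {a : Fin n → ℂ} {u : ℝ × ℝ → Mat n} {O : Set (ℝ × ℝ)} (hO : IsOpen O)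
    {q q' : ℝ × ℝ → (Mat n)⟦X⟧} (hq : IsQSeries a u O q) (hq' : IsQSeries a u O q') :
    Set.EqOn q q' O := by
  have hdvd (m : ℕ) : ∀ z ∈ O, X ^ m ∣ q' z - q z := by
    induction m with
    | zero => simp
    | succ m ih =>
      intro z hz
      refine X_pow_succ_dvd_iff.mpr ⟨ih z hz, ?_⟩
      have hlie : ⁅Matrix.diagonal a, coeff m (q' z - q z)⁆ = 0 := by
        rw [← coeff_covDeriv_connectionSeries (F := fun s => q' (s, z.2) - q (s, z.2)) a (u z)
          ((eventually_mem_slice_fst hO hz).mono fun _ hs => ih _ hs)]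
        have hadd := covDeriv_add (connectionSeries a (u z)) (connectionSeries a (u z))
          (hq.coeffDifferentiableAt z hz)
          ((hq'.coeffDifferentiableAt z hz).sub (hq.coeffDifferentiableAt z hz))
        simp only [add_sub_cancel, hq.covDeriv_eq_zero z hz, hq'.covDeriv_eq_zero z hz,
          zero_add] at hadd
        rw [← hadd, map_zero]
      ext i l
      by_cases hil : a i = a l
      · have hf := (isTwistedDerivation_aeval_sub (K := ℂ) (q z) (q' z)).coeff_apply
          (hq.constantCoeff_eq z hz) (hq'.constantCoeff_eq z hz)
          (by simpa only [Polynomial.aeval_X] using ih z hz) hil (eigenPoly a)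
        simpa [hq.aeval_eigenPoly z hz, hq'.aeval_eigenPoly z hz,
          eval_derivative_eigenPoly_ne_zero] using hf
      · simpa [lie_diagonal_apply, sub_ne_zero.mpr hil] using congrFun₂ hlie i l
  intro z hz
  ext1 k
  have := X_pow_dvd_iff.mp (hdvd (k + 1) z hz) k k.lt_succ_self
  rwa [map_sub, sub_eq_zero, eq_comm] at this

theorem coeff_truncQ (a : Fin n → ℂ) (u : ℝ × ℝ → Mat n) (k i : ℕ) (z : ℝ × ℝ) :
    coeff i (truncQ a u k z) = if i ≤ k then Qa a u i z else 0 := by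
  induction k generalizing i with
  | zero =>
    rcases i.eq_zero_or_pos with rfl | hi
    · rfl
    · simp [truncQ, coeff_C, hi.ne', Nat.not_le.mpr hi]
  | succ k ih =>
    have hsucc : Qa a u (k + 1) z = nextQ a u (truncQ a u k) k z := by
      simp [Qa, truncQ, ih]
    rw [truncQ, map_add, ih, coeff_monomial]
    rcases lt_trichotomy i (k + 1) with h | rfl | h
    · simp [Nat.lt_succ_iff.mp h, h.le, h.ne]
    · simp [hsucc]
    · simp [h.ne', Nat.not_le.mpr h, (k.lt_succ_self.trans h).not_ge]

theorem Qa_zero (a : Fin n → ℂ) (u : ℝ × ℝ → Mat n) (z : ℝ × ℝ) :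
    Qa a u 0 z = Matrix.diagonal a := by
  simp [Qa, truncQ]

theorem Qa_succ (a : Fin n → ℂ) (u : ℝ × ℝ → Mat n) (k : ℕ) (z : ℝ × ℝ) :
    Qa a u (k + 1) z = nextQ a u (truncQ a u k) k z := by
  have := coeff_truncQ a u k (k + 1) z
  simp_all [Qa, truncQ]

theorem constantCoeff_qaSeries (a : Fin n → ℂ) (u : ℝ × ℝ → Mat n) (z : ℝ × ℝ) :
    constantCoeff (qaSeries a u z) = Matrix.diagonal a := by
  rw [qaSeries, ← coeff_zero_eq_constantCoeff_apply, coeff_mk, Qa_zero]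

theorem coeff_aeval_qaSeries_eigenPoly_apply (a : Fin n → ℂ) (u : ℝ × ℝ → Mat n) (z : ℝ × ℝ)
    (m : ℕ) {i l : Fin n} (hil : a i = a l) :
    coeff m (Polynomial.aeval (qaSeries a u z) (eigenPoly a)) i l = 0 := by
  cases m with
  | zero =>
    rw [coeff_zero_eq_constantCoeff_apply, constantCoeff_aeval, constantCoeff_qaSeries,
      aeval_diagonal]
    simp only [eval_eigenPoly, Matrix.diagonal_zero, Matrix.zero_apply]
  | succ k =>
    have htrunc : X ^ (k + 1) ∣ qaSeries a u z - truncQ a u k z := X_pow_dvd_iff.mpr fun i hi => by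
      rw [map_sub, coeff_truncQ, if_pos (Nat.lt_succ_iff.mp hi), qaSeries, coeff_mk, sub_self]
    have hdiff := (isTwistedDerivation_aeval_sub (K := ℂ) (truncQ a u k z)
      (qaSeries a u z)).coeff_apply
      (by rw [← coeff_zero_eq_constantCoeff_apply, coeff_truncQ, if_pos k.zero_le, Qa_zero])
      (constantCoeff_qaSeries a u z) (by simpa only [Polynomial.aeval_X] using htrunc) hil
      (eigenPoly a)
    have hne := eval_derivative_eigenPoly_ne_zero a i
    have hQ : coeff (k + 1) (qaSeries a u z - truncQ a u k z) i l
        = -(coeff (k + 1) (Polynomial.aeval (truncQ a u k z) (eigenPoly a)) i l)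
          / (eigenPoly a).derivative.eval (a i) := by
      simp [qaSeries, coeff_truncQ, Qa_succ, nextQ, hil]
    simp only [Polynomial.aeval_X, hQ, mul_div_cancel₀ _ hne, map_sub, Matrix.sub_apply] at hdiff
    linear_combination hdiff

theorem coeff_covDeriv_qaSeries_apply {a : Fin n → ℂ} {u : ℝ × ℝ → Mat n} {z : ℝ × ℝ}
    (hd : CoeffDifferentiableAt (fun s => qaSeries a u (s, z.2)) z.1) (m : ℕ) {i l : Fin n}
    (hil : a i ≠ a l) :
    coeff m (covDeriv (connectionSeries a (u z)) (connectionSeries a (u z))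
      (fun s => qaSeries a u (s, z.2)) z.1) i l = 0 := by
  cases m with
  | zero =>
    rw [coeff_covDeriv_connectionSeries a _ (.of_forall fun _ => by simp),
      coeff_zero_eq_constantCoeff_apply, constantCoeff_qaSeries, lie_diagonal_apply,
      Matrix.diagonal_apply_ne _ (ne_of_apply_ne a hil), mul_zero]
  | succ k =>
    have hderiv : deriv (fun s => Qa a u k (s, z.2)) z.1 = partialX (Qa a u k) z := by
      simp only [CoeffDifferentiableAt, qaSeries, coeff_mk] at hd
      exact (hasPartialX_iff.mpr (hd k).hasDerivAt).partialX_eq.symm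
    have hcoeff := coeff_succ_covDeriv_C_add_C_mul_X (F := fun s => qaSeries a u (s, z.2))
      (s := z.1) (Matrix.diagonal a) (u z) k
    simp only [qaSeries, coeff_mk] at hcoeff
    have hne : a l - a i ≠ 0 := sub_ne_zero.mpr hil.symm
    have hQ : Qa a u (k + 1) z i l * (a l - a i)
        = (partialX (Qa a u k) z + ⁅u z, Qa a u k z⁆) i l := by
      simp [Qa_succ, nextQ, hil, coeff_truncQ, hne]
    refine (congrFun₂ (hcoeff.trans (congrArg (· + _ + _) hderiv)) i l).trans ?_
    simp only [Matrix.add_apply, lie_diagonal_apply] at hQ ⊢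
    linear_combination -hQ

theorem isQSeries_qaSeries (a : Fin n → ℂ) (u : ℝ × ℝ → Mat n) {O : Set (ℝ × ℝ)} (hO : IsOpen O)
    (hd : ∀ z ∈ O, CoeffDifferentiableAt (fun s => qaSeries a u (s, z.2)) z.1) :
    IsQSeries a u O (qaSeries a u) := by
  let δ (z : ℝ × ℝ) (f : Polynomial ℂ) := covDeriv (connectionSeries a (u z))
    (connectionSeries a (u z)) (fun s => Polynomial.aeval (qaSeries a u (s, z.2)) f) z.1
  have hdvd (m : ℕ) : ∀ z ∈ O, X ^ m ∣ δ z .X ∧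
      X ^ m ∣ Polynomial.aeval (qaSeries a u z) (eigenPoly a) := by
    induction m with
    | zero => simp
    | succ m ih =>
      intro z hz
      have hδ : IsTwistedDerivation (qaSeries a u z) (qaSeries a u z) (δ z) :=
        isTwistedDerivation_covDeriv (connectionSeries a (u z)) (hd z hz)
      have hlie : coeff m (δ z (eigenPoly a)) = ⁅Matrix.diagonal a,
          coeff m (Polynomial.aeval (qaSeries a u z) (eigenPoly a))⁆ :=
        coeff_covDeriv_connectionSeries a (u z)
          ((eventually_mem_slice_fst hO hz).mono fun _ hs => (ih _ hs).2)
      have hX : X ^ (m + 1) ∣ δ z .X := by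
        refine X_pow_succ_dvd_iff.mpr ⟨(ih z hz).1, ?_⟩
        ext i l
        by_cases hil : a i = a l
        · have := hδ.coeff_apply (constantCoeff_qaSeries a u z) (constantCoeff_qaSeries a u z)
            (ih z hz).1 hil (eigenPoly a)
          rw [hlie, lie_diagonal_apply, hil, sub_self, zero_mul, ← hil, zero_eq_mul] at this
          exact this.resolve_left (eval_derivative_eigenPoly_ne_zero a i)
        · simpa only [δ, Polynomial.aeval_X, Matrix.zero_apply] using
            coeff_covDeriv_qaSeries_apply (hd z hz) m hil
      refine ⟨hX, X_pow_succ_dvd_iff.mpr ⟨(ih z hz).2, ?_⟩⟩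
      rw [(X_pow_succ_dvd_iff.mp (hδ.X_pow_dvd hX (eigenPoly a))).2] at hlie
      ext i l
      by_cases hil : a i = a l
      · exact coeff_aeval_qaSeries_eigenPoly_apply a u z m hil
      · simpa [lie_diagonal_apply, sub_ne_zero.mpr hil] using (congrFun₂ hlie i l).symm
  have hzero {φ : (Mat n)⟦X⟧} (h : ∀ m, X ^ m ∣ φ) : φ = 0 := by
    ext1 k
    exact X_pow_dvd_iff.mp (h (k + 1)) k k.lt_succ_self
  exact ⟨fun z _ => constantCoeff_qaSeries a u z, hd,
    fun z hz => by simpa only [δ, Polynomial.aeval_X] using hzero fun m => (hdvd m z hz).1,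
    fun z hz => hzero fun m => (hdvd m z hz).2⟩

end Recursion

section Gauge

open PowerSeries
open scoped Matrix.Norms.Operator

theorem contDiffOn_coeff_aeval {K H 𝔸 : Type*} [CommRing K] [NormedAddCommGroup H]
    [NormedSpace ℝ H] [NormedRing 𝔸] [NormedAlgebra ℝ 𝔸] [Algebra K 𝔸] {O : Set H} {q : H → 𝔸⟦X⟧}
    (hq : ∀ k, ContDiffOn ℝ ∞ (fun z => coeff k (q z)) O) (f : Polynomial K) (k : ℕ) :
    ContDiffOn ℝ ∞ (fun z => coeff k (Polynomial.aeval (q z) f)) O := by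
  have hmul_X (f : Polynomial K)
      (hf : ∀ k, ContDiffOn ℝ ∞ (fun z => coeff k (Polynomial.aeval (q z) f)) O) (k : ℕ) :
      ContDiffOn ℝ ∞ (fun z => coeff k (Polynomial.aeval (q z) (f * .X))) O := by
    simp only [map_mul, Polynomial.aeval_X, coeff_mul]
    exact .sum fun x _ => (hf x.1).mul (hq x.2)
  induction f using Polynomial.induction_on generalizing k with
  | C c => simpa only [Polynomial.aeval_C] using contDiffOn_const
  | add f g hf hg => simpa only [map_add] using (hf k).add (hg k)
  | monomial m c h => simpa only [pow_succ, mul_assoc] using hmul_X _ h k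

variable {n : ℕ} {O : Set (ℝ × ℝ)}

theorem contDiffOn_Qa (hO : IsOpen O) (a : Fin n → ℂ) {u : ℝ × ℝ → Mat n}
    (hu : ContDiffOn ℝ ∞ u O) (k : ℕ) : ContDiffOn ℝ ∞ (Qa a u k) O := by
  induction k using Nat.strong_induction_on with
  | _ k ih =>
    cases k with
    | zero => exact contDiffOn_const.congr fun z _ => Qa_zero a u z
    | succ k =>
      have hq (i : ℕ) : ContDiffOn ℝ ∞ (fun z => coeff i (truncQ a u k z)) O := by
        simp only [coeff_truncQ]
        split_ifs with hi
        · exact ih i (Nat.lt_succ_of_le hi)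
        · exact contDiffOn_const
      have halg := smoothOn_iff.mpr (contDiffOn_coeff_aeval hq (eigenPoly a) (k + 1))
      have hrec := smoothOn_iff.mpr ((contDiffOn_partialX hO (hq k)).add
        ((hu.mul (hq k)).sub ((hq k).mul hu)))
      refine smoothOn_iff.mp fun i l => ?_
      simp only [Qa_succ, nextQ, Matrix.of_apply]
      split_ifs
      · exact (halg i l).neg.div_const _
      · exact (hrec i l).div_const _

theorem contDiffOn_Qb (hO : IsOpen O) (a : Fin n → ℂ) (p : Polynomial ℂ) {u : ℝ × ℝ → Mat n}
    (hu : ContDiffOn ℝ ∞ u O) (k : ℕ) : ContDiffOn ℝ ∞ (Qb a p u k) O :=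
  contDiffOn_coeff_aeval
    (fun k => by simpa only [coeff_mk] using contDiffOn_Qa hO a hu k) p k

/-- The gauge transformation `λ - τ`, multiplied by `X = λ⁻¹`. -/
noncomputable def gaugeSeries {A : Type*} [Ring A] (τ : A) : A⟦X⟧ˣ where
  val := 1 - C τ * X
  inv := mk (τ ^ ·)
  val_inv := by
    rw [sub_mul, one_mul, mul_assoc, X_mul, ← mul_assoc]
    ext k
    cases k <;> simp [pow_succ', coeff_one]
  inv_val := by
    rw [mul_sub, mul_one, ← mul_assoc]
    ext k
    cases k <;> simp [pow_succ, coeff_one]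

section

variable {𝔸 : Type*} [NormedRing 𝔸] [NormedAlgebra ℝ 𝔸] {τ : ℝ → 𝔸} {s : ℝ}

theorem coeffDifferentiableAt_gaugeSeries (hτ : DifferentiableAt ℝ τ s) :
    CoeffDifferentiableAt (fun r => (gaugeSeries (τ r) : 𝔸⟦X⟧)) s := by
  rintro (_ | _ | k)
  · simp [gaugeSeries]
  · simpa [gaugeSeries, coeff_one] using hτ.fun_neg
  · simp [gaugeSeries, coeff_one]

theorem coeffDifferentiableAt_gaugeSeries_inv (hτ : DifferentiableAt ℝ τ s) :
    CoeffDifferentiableAt (fun r => ((gaugeSeries (τ r))⁻¹ : 𝔸⟦X⟧ˣ).val) s := fun k => by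
  simpa only [gaugeSeries, Units.inv_mk, coeff_mk] using hτ.fun_pow k

theorem covDeriv_gaugeSeries {A U : 𝔸} (hτ : HasDerivAt τ (-⁅U, τ s⁆ - ⁅A, τ s⁆ * τ s) s) :
    covDeriv (C A + C (U + ⁅A, τ s⁆) * X) (C A + C U * X)
      (fun r => (gaugeSeries (τ r) : 𝔸⟦X⟧)) s = 0 := by
  have hderiv : coeffDeriv (fun r => (gaugeSeries (τ r) : 𝔸⟦X⟧)) s
      = C (⁅U, τ s⁆ + ⁅A, τ s⁆ * τ s) * X := by
    ext k
    rw [coeffDeriv, coeff_mk]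
    rcases k with _ | _ | k
    · simp [gaugeSeries]
    · simpa [gaugeSeries, coeff_one, hτ.deriv] using add_comm _ _
    · simp [gaugeSeries, coeff_one]
  have hX (c : 𝔸) (φ : 𝔸⟦X⟧) : X * (C c * φ) = C c * (X * φ) := by
    rw [X_mul, mul_assoc, X_mul]
  rw [covDeriv, hderiv]
  simp only [gaugeSeries, Ring.lie_def, map_add, map_sub, map_mul, mul_add,
    add_mul, mul_sub, sub_mul, mul_one, one_mul, mul_assoc, hX, X_mul (φ := C _)]
  abel

theorem covDeriv_conj {P P' : 𝔸⟦X⟧} {g : ℝ → 𝔸⟦X⟧ˣ} {F : ℝ → 𝔸⟦X⟧}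
    (hg : CoeffDifferentiableAt (fun r => (g r : 𝔸⟦X⟧)) s)
    (hg' : CoeffDifferentiableAt (fun r => ((g r)⁻¹ : 𝔸⟦X⟧ˣ).val) s)
    (hF : CoeffDifferentiableAt F s) (hgauge : covDeriv P' P (fun r => (g r : 𝔸⟦X⟧)) s = 0)
    (hP : covDeriv P P F s = 0) :
    covDeriv P' P' (fun r => g r * F r * ((g r)⁻¹ : 𝔸⟦X⟧ˣ).val) s = 0 := by
  have hleft := covDeriv_mul P' P' P ((hg.mul hF).mul hg') hg
  have hright := covDeriv_mul P' P P hg hF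
  simp only [Units.inv_mul_cancel_right, hgauge, hP, zero_mul, mul_zero, add_zero]
    at hleft hright
  exact (g s).mul_left_eq_zero.mp (hleft.symm.trans hright)

end

theorem semiconjBy_aeval {K A : Type*} [CommRing K] [Ring A] [Algebra K A] {g x y : A}
    (h : SemiconjBy g x y) (f : Polynomial K) :
    SemiconjBy g (Polynomial.aeval x f) (Polynomial.aeval y f) := by
  induction f using Polynomial.induction_on with
  | C c =>
    rw [Polynomial.aeval_C, Polynomial.aeval_C]
    exact Algebra.commute_algebraMap_right c g
  | add f f' hf hf' => simpa only [map_add] using hf.add_right hf'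
  | monomial k c hk =>
    simpa only [map_mul, map_pow, Polynomial.aeval_X, pow_succ, mul_assoc] using hk.mul_right h

theorem IsQSeries.gauge {a : Fin n → ℂ} {u τ : ℝ × ℝ → Mat n} {q : ℝ × ℝ → (Mat n)⟦X⟧}
    (hq : IsQSeries a u O q)
    (hτ : ∀ z ∈ O, HasPartialX τ (-⁅u z, τ z⁆ - ⁅Matrix.diagonal a, τ z⁆ * τ z) z) :
    IsQSeries a (fun z => u z + ⁅Matrix.diagonal a, τ z⁆) O
      fun z => gaugeSeries (τ z) * q z * ((gaugeSeries (τ z))⁻¹ : (Mat n)⟦X⟧ˣ).val := by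
  have hτ' (z : ℝ × ℝ) (hz : z ∈ O) := hasPartialX_iff.mp (hτ z hz)
  have hg (z : ℝ × ℝ) (hz : z ∈ O) :=
    coeffDifferentiableAt_gaugeSeries (hτ' z hz).differentiableAt
  have hg' (z : ℝ × ℝ) (hz : z ∈ O) :=
    coeffDifferentiableAt_gaugeSeries_inv (hτ' z hz).differentiableAt
  refine ⟨fun z hz => ?_, fun z hz => ((hg z hz).mul (hq.coeffDifferentiableAt z hz)).mul
    (hg' z hz), fun z hz => ?_, fun z hz => ?_⟩
  · have hinv : constantCoeff ((gaugeSeries (τ z))⁻¹ : (Mat n)⟦X⟧ˣ).val = 1 := by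
      rw [gaugeSeries, Units.inv_mk, ← coeff_zero_eq_constantCoeff_apply, coeff_mk, pow_zero]
    rw [map_mul, map_mul, hinv, hq.constantCoeff_eq z hz]
    simp [gaugeSeries]
  · have hgauge := covDeriv_gaugeSeries (hτ' z hz)
    exact covDeriv_conj (hg z hz) (hg' z hz) (hq.coeffDifferentiableAt z hz) hgauge
      (hq.covDeriv_eq_zero z hz)
  · refine (gaugeSeries (τ z)).mul_left_eq_zero.mp ?_
    rw [← (semiconjBy_aeval ((gaugeSeries (τ z)).mk_semiconjBy _) (eigenPoly a)).eq,
      hq.aeval_eigenPoly z hz, mul_zero]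

theorem isQSeries_qaSeries_of_contDiffOn (hO : IsOpen O) (a : Fin n → ℂ) {u : ℝ × ℝ → Mat n}
    (hu : ContDiffOn ℝ ∞ u O) : IsQSeries a u O (qaSeries a u) :=
  isQSeries_qaSeries a u hO fun z hz k => by
    simpa only [qaSeries, coeff_mk] using (hasDerivAt_slice_fst
      (((contDiffOn_Qa hO a hu k).contDiffAt (hO.mem_nhds hz)).differentiableAt
        (by simp))).differentiableAt

theorem semiconjBy_gaugeSeries_aeval_qaSeries (hO : IsOpen O) (a : Fin n → ℂ)
    (p : Polynomial ℂ) {u τ : ℝ × ℝ → Mat n} (hu : ContDiffOn ℝ ∞ u O) (hτs : ContDiffOn ℝ ∞ τ O)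
    (hτ : ∀ z ∈ O, HasPartialX τ (-⁅u z, τ z⁆ - ⁅Matrix.diagonal a, τ z⁆ * τ z) z) {z : ℝ × ℝ}
    (hz : z ∈ O) :
    SemiconjBy (gaugeSeries (τ z) : (Mat n)⟦X⟧) (Polynomial.aeval (qaSeries a u z) p)
      (Polynomial.aeval (qaSeries a (fun z => u z + ⁅Matrix.diagonal a, τ z⁆) z) p) := by
  have hu' : ContDiffOn ℝ ∞ (fun z => u z + ⁅Matrix.diagonal a, τ z⁆) O :=
    hu.add ((contDiffOn_const.mul hτs).sub (hτs.mul contDiffOn_const))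
  rw [(isQSeries_qaSeries_of_contDiffOn hO a hu').eqOn hO
    ((isQSeries_qaSeries_of_contDiffOn hO a hu).gauge hτ) hz]
  exact semiconjBy_aeval ((gaugeSeries (τ z)).mk_semiconjBy _) p

end Gauge

section LaxSymbol

open PowerSeries

variable {K A : Type*} [CommRing K] [Ring A] [Algebra K A] {B B' : A⟦X⟧} {τ : A} {j : ℕ}

/-- The polynomial part of `λ^j B` at `λ = l`, where `B` is a power series in `λ⁻¹`. It is the
coefficient matrix of the linear systems that are satisfied by a trivialization. -/
noncomputable def laxSymbol (B : A⟦X⟧) (j : ℕ) (l : K) : A :=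
  ∑ k ∈ Finset.range (j + 1), l ^ k • coeff (j - k) B

theorem laxSymbol_zero (B : A⟦X⟧) (l : K) : laxSymbol B 0 l = coeff 0 B := by
  simp [laxSymbol]

theorem laxSymbol_succ (B : A⟦X⟧) (j : ℕ) (l : K) :
    laxSymbol B (j + 1) l = l • laxSymbol B j l + coeff (j + 1) B := by
  simp [laxSymbol, Finset.sum_range_succ' _ (j + 1), Finset.smul_sum, smul_smul, pow_succ']

theorem laxSymbol_apply_zero (B : A⟦X⟧) (j : ℕ) : laxSymbol B j (0 : K) = coeff j B := by
  simp [laxSymbol, Finset.sum_range_succ']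

/-- `(λ - τ) B = B' (λ - τ)` up to terms of order `j` in `λ⁻¹`, after division by `λ`. -/
structure IsGaugeRelated (j : ℕ) (τ : A) (B B' : A⟦X⟧) : Prop where
  coeff_zero : coeff 0 B' = coeff 0 B
  coeff_succ : ∀ k < j, coeff (k + 1) B' - coeff k B' * τ = coeff (k + 1) B - τ * coeff k B

theorem IsGaugeRelated.mono {i : ℕ} (h : IsGaugeRelated j τ B B') (hij : i ≤ j) :
    IsGaugeRelated i τ B B' :=
  ⟨h.coeff_zero, fun k hk => h.coeff_succ k (hk.trans_le hij)⟩

theorem isGaugeRelated_of_semiconjBy (h : SemiconjBy (gaugeSeries τ : A⟦X⟧) B B') (j : ℕ) :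
    IsGaugeRelated j τ B B' where
  coeff_zero := by simpa [gaugeSeries] using congrArg (coeff 0) h.eq.symm
  coeff_succ k _ := by
    simpa [gaugeSeries, mul_sub, sub_mul, ← mul_assoc, mul_assoc _ X B, X_mul (φ := B)]
      using congrArg (coeff (k + 1)) h.eq.symm

theorem IsGaugeRelated.laxSymbol_mul_sub (h : IsGaugeRelated j τ B B') (l : K) :
    laxSymbol B' j l * (l • 1 - τ) - (l • 1 - τ) * laxSymbol B j l
      = τ * coeff j B - coeff j B' * τ := by
  induction j with
  | zero =>
    simp only [laxSymbol_zero, h.coeff_zero, mul_sub, sub_mul, mul_smul_comm, smul_mul_assoc,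
      mul_one, one_mul]
    abel
  | succ j ih =>
    have hB' := sub_eq_iff_eq_add.mp (h.coeff_succ j j.lt_succ_self)
    have hih := sub_eq_iff_eq_add.mp (ih (h.mono j.le_succ))
    rw [laxSymbol_succ, laxSymbol_succ, add_mul, mul_add, smul_mul_assoc, mul_smul_comm, hih, hB']
    simp only [mul_sub, sub_mul, add_mul, mul_smul_comm, smul_mul_assoc, mul_one, smul_sub,
      smul_add, one_mul]
    abel

theorem IsGaugeRelated.neg_sum_lie_mul_pow (h : IsGaugeRelated j τ B B') :
    -∑ k ∈ Finset.range (j + 1), ⁅coeff (j - k) B, τ⁆ * τ ^ k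
      = τ * coeff j B - coeff j B' * τ := by
  induction j with
  | zero =>
    rw [zero_add, Finset.sum_range_one, pow_zero, mul_one, h.coeff_zero, Ring.lie_def, neg_sub]
  | succ j ih =>
    have hB' := sub_eq_iff_eq_add.mp (h.coeff_succ j j.lt_succ_self)
    have hih := congrArg (· * τ) (ih (h.mono j.le_succ))
    simp only [neg_mul, Finset.sum_mul, mul_assoc, ← pow_succ] at hih
    simp only [Finset.sum_range_succ' _ (j + 1), neg_add, Nat.add_sub_add_right, hih]
    rw [pow_zero, mul_one, Nat.sub_zero, hB', Ring.lie_def]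
    noncomm_ring

/-- The affine image of the idempotent `σ` that has the eigenvalues `α₁` on `Im σ` and `α₂` on
`Im (1 - σ)`. -/
def spectralPencil (α₁ α₂ : K) (σ : A) : A :=
  α₂ • 1 + (α₁ - α₂) • σ

theorem lie_spectralPencil (α₁ α₂ : K) (b σ : A) :
    ⁅b, spectralPencil α₁ α₂ σ⁆ = (α₁ - α₂) • ⁅b, σ⁆ := by
  simp only [spectralPencil, Ring.lie_def, mul_add, add_mul, mul_smul_comm, smul_mul_assoc,
    mul_one, one_mul, smul_sub]
  abel

theorem spectralPencil_pow {σ : A} (hσ : IsIdempotentElem σ) (α₁ α₂ : K) (k : ℕ) :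
    spectralPencil α₁ α₂ σ ^ k = α₁ ^ k • σ + α₂ ^ k • (1 - σ) := by
  induction k with
  | zero => simp
  | succ k ih =>
    rw [pow_succ, ih, spectralPencil]
    simp only [add_mul, mul_add, smul_mul_smul_comm, hσ.eq, sub_mul, mul_one, one_mul, sub_self,
      smul_zero, add_zero, pow_succ]
    module

theorem neg_sum_lie_mul_spectralPencil_pow {σ : A} (hσ : IsIdempotentElem σ) (B : A⟦X⟧) (j : ℕ)
    (α₁ α₂ : K) :
    -∑ k ∈ Finset.range (j + 1), ⁅coeff (j - k) B, σ⁆ * spectralPencil α₁ α₂ σ ^ k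
      = σ * laxSymbol B j α₂ * (1 - σ) - (1 - σ) * laxSymbol B j α₁ * σ := by
  have hterm (k : ℕ) (b : A) : ⁅b, σ⁆ * spectralPencil α₁ α₂ σ ^ k
      = (1 - σ) * (α₁ ^ k • b) * σ - σ * (α₂ ^ k • b) * (1 - σ) := by
    have hσ₁ : ⁅b, σ⁆ * σ = (1 - σ) * b * σ := by
      rw [Ring.lie_def, sub_mul, mul_assoc b, hσ.eq, sub_mul, one_mul, sub_mul]
    have hσ₂ : ⁅b, σ⁆ * (1 - σ) = -(σ * b * (1 - σ)) := by
      rw [Ring.lie_def, sub_mul, mul_assoc b, hσ.mul_one_sub_self, mul_zero, zero_sub]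
    rw [spectralPencil_pow hσ, mul_add, mul_smul_comm, mul_smul_comm, hσ₁, hσ₂]
    simp only [mul_smul_comm, smul_mul_assoc, smul_neg, sub_eq_add_neg]
  simp only [hterm, Finset.sum_sub_distrib, ← Finset.mul_sum, ← Finset.sum_mul, neg_sub]
  rfl

theorem IsGaugeRelated.smul_neg_sum_lie_mul_spectralPencil_pow {σ : A} {α₁ α₂ : K}
    (h : IsGaugeRelated j (spectralPencil α₁ α₂ σ) B B') (l : K) :
    (α₁ - α₂) • -∑ k ∈ Finset.range (j + 1), ⁅coeff (j - k) B, σ⁆ * spectralPencil α₁ α₂ σ ^ k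
      = laxSymbol B' j l * (l • 1 - spectralPencil α₁ α₂ σ)
        - (l • 1 - spectralPencil α₁ α₂ σ) * laxSymbol B j l := by
  rw [h.laxSymbol_mul_sub, ← h.neg_sum_lie_mul_pow]
  simp only [lie_spectralPencil, smul_neg, Finset.smul_sum, smul_mul_assoc]

end LaxSymbol

section TransformedProjection

/-- When invertible, this maps `A₁⁻¹(Im π)` onto `Im π` and `A₂⁻¹(Im (1 - π))` onto
`Im (1 - π)`. -/
def dressingFrame {A : Type*} [Ring A] (A₁ A₂ π : A) : A :=
  (1 - π) * A₁ + π * A₂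

theorem one_sub_mul_dressingFrame {A : Type*} [Ring A] {π : A} (hπ : IsIdempotentElem π)
    (A₁ A₂ : A) : (1 - π) * dressingFrame A₁ A₂ π = (1 - π) * A₁ := by
  simp only [dressingFrame, mul_add, ← mul_assoc, hπ.one_sub.eq, hπ.one_sub_mul_self, zero_mul,
    add_zero]

theorem mul_dressingFrame {A : Type*} [Ring A] {π : A} (hπ : IsIdempotentElem π)
    (A₁ A₂ : A) : π * dressingFrame A₁ A₂ π = π * A₂ := by
  simp only [dressingFrame, mul_add, ← mul_assoc, hπ.mul_one_sub_self, hπ.eq, zero_mul, zero_add]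

/-- `σ` is the projection onto `A₁⁻¹(Im π)` along `A₂⁻¹(Im (1 - π))`. The two subspaces are the
kernels of `(1 - π) A₁` and `π A₂`, and the existential clauses express that these kernels are not
larger than those of `1 - σ` and `σ`. -/
structure IsTransformedProj {A : Type*} [Ring A] (A₁ A₂ π σ : A) : Prop where
  one_sub_mul_mul_self : (1 - π) * A₁ * σ = 0
  mul_mul_one_sub_self : π * A₂ * (1 - σ) = 0
  exists_mul_eq_one_sub : ∃ L, L * ((1 - π) * A₁) = 1 - σ
  exists_mul_eq_self : ∃ L, L * (π * A₂) = σ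

namespace IsTransformedProj

section Ring

variable {A : Type*} [Ring A] {A₁ A₂ π σ : A}

theorem idem (h : IsTransformedProj A₁ A₂ π σ) : IsIdempotentElem σ := by
  obtain ⟨L, hL⟩ := h.exists_mul_eq_self
  have hσ : σ * (1 - σ) = 0 := by
    nth_rw 1 [← hL]
    rw [mul_assoc, h.mul_mul_one_sub_self, mul_zero]
  rwa [mul_one_sub, sub_eq_zero, eq_comm] at hσ

theorem mul_eq_of_one_sub_mul_mul_eq_zero {Y : A} (h : IsTransformedProj A₁ A₂ π σ)
    (hY : (1 - π) * A₁ * Y = 0) : σ * Y = Y := by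
  obtain ⟨L, hL⟩ := h.exists_mul_eq_one_sub
  rw [eq_comm, ← sub_eq_zero, ← one_sub_mul, ← hL, mul_assoc, hY, mul_zero]

theorem mul_eq_zero_of_mul_mul_eq_zero {Y : A} (h : IsTransformedProj A₁ A₂ π σ)
    (hY : π * A₂ * Y = 0) : σ * Y = 0 := by
  obtain ⟨L, hL⟩ := h.exists_mul_eq_self
  rw [← hL, mul_assoc, hY, mul_zero]

theorem eq_of_mul_eq_zero {ρ : A} (h : IsTransformedProj A₁ A₂ π σ)
    (h₁ : (1 - π) * A₁ * ρ = 0) (h₂ : π * A₂ * (1 - ρ) = 0) : ρ = σ := by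
  rw [← h.mul_eq_of_one_sub_mul_mul_eq_zero h₁, eq_comm, ← sub_eq_zero, ← mul_one_sub]
  exact h.mul_eq_zero_of_mul_mul_eq_zero h₂

theorem of_isUnit (hπ : IsIdempotentElem π) (h : IsUnit (dressingFrame A₁ A₂ π)) :
    IsTransformedProj A₁ A₂ π
      (Ring.inverse (dressingFrame A₁ A₂ π) * π * dressingFrame A₁ A₂ π) := by
  set N := dressingFrame A₁ A₂ π with hN
  have hσ : 1 - Ring.inverse N * π * N = Ring.inverse N * ((1 - π) * N) := by
    rw [sub_mul, one_mul, mul_sub, Ring.inverse_mul_cancel _ h, mul_assoc]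
  refine ⟨?_, ?_, ⟨Ring.inverse N, ?_⟩, ⟨Ring.inverse N, ?_⟩⟩
  · rw [← one_sub_mul_dressingFrame hπ A₁ A₂, ← hN, mul_assoc, ← mul_assoc N, ← mul_assoc N,
      Ring.mul_inverse_cancel _ h, one_mul, ← mul_assoc, hπ.one_sub_mul_self, zero_mul]
  · rw [hσ, ← mul_dressingFrame hπ A₁ A₂, ← hN, mul_assoc, Ring.mul_inverse_cancel_left _ _ h,
      ← mul_assoc, hπ.mul_one_sub_self, zero_mul]
  · rw [← one_sub_mul_dressingFrame hπ A₁ A₂, hσ]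
  · rw [← mul_dressingFrame hπ A₁ A₂, mul_assoc]

end Ring

/-- Differentiate `(1 - π) A₁ σ = 0` and `π A₂ (1 - σ) = 0`. -/
theorem deriv_eq {𝔸 : Type*} [NormedRing 𝔸] [NormedAlgebra ℝ 𝔸] {A₁ A₂ σ : ℝ → 𝔸}
    {π σ' G₁ G₂ : 𝔸} {s : ℝ} (h : ∀ᶠ r in nhds s, IsTransformedProj (A₁ r) (A₂ r) π (σ r))
    (hA₁ : HasDerivAt A₁ (A₁ s * G₁) s) (hA₂ : HasDerivAt A₂ (A₂ s * G₂) s)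
    (hσ : HasDerivAt σ σ' s) :
    σ' = σ s * G₂ * (1 - σ s) - (1 - σ s) * G₁ * σ s := by
  have hs := h.self_of_nhds
  have d₁ : (1 - π) * A₁ s * (G₁ * σ s + σ') = 0 := by
    have := ((hA₁.const_mul (1 - π)).mul hσ).unique
      ((hasDerivAt_const s (0 : 𝔸)).congr_of_eventuallyEq
        (h.mono fun r hr => hr.one_sub_mul_mul_self))
    simpa only [mul_add, mul_assoc] using this
  have d₂ : π * A₂ s * (G₂ * (1 - σ s) - σ') = 0 := by
    have := ((hA₂.const_mul π).mul (hσ.const_sub 1)).unique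
      ((hasDerivAt_const s (0 : 𝔸)).congr_of_eventuallyEq
        (h.mono fun r hr => hr.mul_mul_one_sub_self))
    simpa only [mul_sub, mul_neg, ← sub_eq_add_neg, mul_assoc] using this
  have e₁ := hs.mul_eq_of_one_sub_mul_mul_eq_zero d₁
  have e₂ := hs.mul_eq_zero_of_mul_mul_eq_zero d₂
  have e₃ : σ' = σ s * σ' - (1 - σ s) * G₁ * σ s := by
    linear_combination (norm := noncomm_ring) -e₁
  rw [mul_sub, sub_eq_zero, ← mul_assoc] at e₂
  rw [e₂, ← e₃]

end IsTransformedProj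

section Matrix

variable {n : ℕ} {A₁ A₂ π : Mat n}

theorem mem_pullbackRange_iff {A P : Mat n} (hP : IsIdempotentElem P) (v : Fin n → ℂ) :
    v ∈ pullbackRange A P ↔ Matrix.mulVec ((1 - P) * A) v = 0 := by
  rw [← Matrix.mulVec_mulVec, Matrix.sub_mulVec, Matrix.one_mulVec, sub_eq_zero, eq_comm]
  refine ⟨fun ⟨w, hw⟩ => ?_, fun h => ⟨_, h⟩⟩
  rw [Matrix.toLin'_apply, Matrix.toLin'_apply] at hw
  rw [← hw, Matrix.mulVec_mulVec, hP.eq]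

theorem mem_pullbackRange_one_sub_iff {A P : Mat n} (hP : IsIdempotentElem P) (v : Fin n → ℂ) :
    v ∈ pullbackRange A (1 - P) ↔ Matrix.mulVec (P * A) v = 0 := by
  rw [mem_pullbackRange_iff hP.one_sub, sub_sub_cancel]

theorem pullbackRange_inf_eq_bot_iff (hπ : IsIdempotentElem π) :
    pullbackRange A₁ π ⊓ pullbackRange A₂ (1 - π) = ⊥ ↔ IsUnit (dressingFrame A₁ A₂ π) := by
  rw [← Matrix.mulVec_injective_iff_isUnit, Submodule.eq_bot_iff,
    ← Matrix.coe_mulVecLin, injective_iff_map_eq_zero]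
  refine forall_congr' fun v => imp_congr ?_ Iff.rfl
  rw [Submodule.mem_inf, mem_pullbackRange_iff hπ, mem_pullbackRange_one_sub_iff hπ,
    Matrix.mulVecLin_apply]
  refine ⟨fun h => by rw [dressingFrame, Matrix.add_mulVec, h.1, h.2, add_zero], fun h => ?_⟩
  rw [← one_sub_mul_dressingFrame hπ A₁ A₂, ← mul_dressingFrame hπ A₁ A₂,
    ← Matrix.mulVec_mulVec, ← Matrix.mulVec_mulVec, h, Matrix.mulVec_zero, Matrix.mulVec_zero]
  exact ⟨rfl, rfl⟩

namespace IsTransformedProj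

variable {σ : Mat n}

theorem pullbackRange_eq_range (h : IsTransformedProj A₁ A₂ π σ) (hπ : IsIdempotentElem π) :
    pullbackRange A₁ π = LinearMap.range (Matrix.toLin' σ) := by
  ext v
  rw [mem_pullbackRange_iff hπ]
  refine ⟨fun hv => ⟨v, ?_⟩, ?_⟩
  · obtain ⟨L, hL⟩ := h.exists_mul_eq_one_sub
    rw [Matrix.toLin'_apply, eq_comm, ← sub_eq_zero]
    simpa only [hL, Matrix.mulVec_mulVec, Matrix.sub_mulVec, Matrix.one_mulVec,
      Matrix.mulVec_zero] using congrArg (Matrix.mulVec L) hv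
  · rintro ⟨w, rfl⟩
    rw [Matrix.toLin'_apply, Matrix.mulVec_mulVec, h.one_sub_mul_mul_self, Matrix.zero_mulVec]

theorem pullbackRange_one_sub_eq_ker (h : IsTransformedProj A₁ A₂ π σ)
    (hπ : IsIdempotentElem π) :
    pullbackRange A₂ (1 - π) = LinearMap.ker (Matrix.toLin' σ) := by
  ext v
  rw [mem_pullbackRange_one_sub_iff hπ, LinearMap.mem_ker, Matrix.toLin'_apply]
  refine ⟨fun hv => ?_, fun hv => ?_⟩
  · obtain ⟨L, hL⟩ := h.exists_mul_eq_self
    rw [← hL, ← Matrix.mulVec_mulVec, hv, Matrix.mulVec_zero]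
  · rw [← Matrix.zero_mulVec v, ← h.mul_mul_one_sub_self, ← Matrix.mulVec_mulVec v _ (1 - σ),
      Matrix.sub_mulVec, Matrix.one_mulVec, hv, sub_zero]

theorem isCompl_pullbackRange (h : IsTransformedProj A₁ A₂ π σ) (hπ : IsIdempotentElem π) :
    IsCompl (pullbackRange A₁ π) (pullbackRange A₂ (1 - π)) := by
  rw [h.pullbackRange_eq_range hπ, h.pullbackRange_one_sub_eq_ker hπ]
  exact LinearMap.IsIdempotentElem.isCompl (h.idem.map Matrix.toLinAlgEquiv')

theorem projMatrix_eq (h : IsTransformedProj A₁ A₂ π σ) (hπ : IsIdempotentElem π) :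
    projMatrix (pullbackRange A₁ π) (pullbackRange A₂ (1 - π)) = σ := by
  have hσ := LinearMap.IsIdempotentElem.eq_projection (h.idem.map Matrix.toLinAlgEquiv')
  rw [projMatrix, dif_pos (h.isCompl_pullbackRange hπ)]
  simp only [h.pullbackRange_eq_range hπ, h.pullbackRange_one_sub_eq_ker hπ]
  exact (congrArg LinearMap.toMatrix' hσ).symm.trans (LinearMap.toMatrix'_toLin' σ)

end IsTransformedProj

end Matrix

end TransformedProjection

section LaxPair

open PowerSeries
open scoped Matrix.Norms.Operator

variable {n : ℕ} {a : Fin n → ℂ} {p : Polynomial ℂ} {j : ℕ} {O : Set (ℝ × ℝ)}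
  {u : ℝ × ℝ → Mat n} {z : ℝ × ℝ}

theorem laxSymbol_connectionSeries (a : Fin n → ℂ) (U : Mat n) (l : ℂ) :
    laxSymbol (connectionSeries a U) 1 l = l • Matrix.diagonal a + U := by
  simp [laxSymbol, connectionSeries, Finset.sum_range_succ, coeff_C, add_comm]

theorem isGaugeRelated_connectionSeries (a : Fin n → ℂ) (U τ : Mat n) :
    IsGaugeRelated 1 τ (connectionSeries a U)
      (connectionSeries a (U + ⁅Matrix.diagonal a, τ⁆)) where
  coeff_zero := by simp [connectionSeries]
  coeff_succ k hk := by
    obtain rfl := Nat.lt_one_iff.mp hk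
    simp only [connectionSeries, map_add, coeff_C, coeff_succ_mul_X, Ring.lie_def]
    simp only [zero_add, one_ne_zero, ↓reduceIte, map_sub, map_mul, coeff_zero_eq_constantCoeff,
      map_add, constantCoeff_C, constantCoeff_X, mul_zero, add_zero, coeff_C_mul, coeff_zero_X]
    abel

theorem laxSymbol_aeval_qaSeries (a : Fin n → ℂ) (p : Polynomial ℂ) (u : ℝ × ℝ → Mat n)
    (z : ℝ × ℝ) (j : ℕ) (l : ℂ) :
    laxSymbol (Polynomial.aeval (qaSeries a u z) p) j l
      = l ^ j • Polynomial.aeval (Matrix.diagonal a) p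
        + ∑ k ∈ Finset.Icc 1 j, l ^ (j - k) • Qb a p u k z := by
  have hzero : coeff 0 (Polynomial.aeval (qaSeries a u z) p)
      = Polynomial.aeval (Matrix.diagonal a) p := by
    rw [coeff_zero_eq_constantCoeff_apply, constantCoeff_aeval, constantCoeff_qaSeries]
  rw [laxSymbol, ← Finset.sum_flip, Finset.range_eq_Ico,
    Finset.sum_eq_sum_Ico_succ_bot j.succ_pos, Nat.sub_zero, Nat.sub_self, hzero, zero_add,
    Nat.succ_eq_add_one, Finset.Ico_add_one_right_eq_Icc]
  refine congrArg _ (Finset.sum_congr rfl fun k hk => ?_)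
  rw [Nat.sub_sub_self (Finset.mem_Icc.mp hk).2]
  rfl

theorem neg_sum_lie_connectionSeries (a : Fin n → ℂ) (U σ τ : Mat n) :
    -∑ k ∈ Finset.range (1 + 1), ⁅coeff (1 - k) (connectionSeries a U), σ⁆ * τ ^ k
      = -⁅U, σ⁆ - ⁅Matrix.diagonal a, σ⁆ * τ := by
  simp only [Nat.reduceAdd, connectionSeries, map_add, coeff_C, coeff_C_mul,
    Finset.sum_range_succ, Finset.range_one, Finset.sum_singleton, tsub_zero, one_ne_zero,
    ↓reduceIte, coeff_one_X, mul_one, zero_add, pow_zero, tsub_self, coeff_zero_X, mul_zero,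
    add_zero, pow_one, neg_add_rev]
  abel

theorem IsTrivialization.hasDerivAt_fst {E : ℝ × ℝ → ℂ → Mat n}
    (hE : IsTrivialization a p j O u E) (hz : z ∈ O) (l : ℂ) :
    HasDerivAt (fun s => E (s, z.2) l) (E z l * laxSymbol (connectionSeries a (u z)) 1 l) z.1 := by
  rw [laxSymbol_connectionSeries]
  exact hasPartialX_iff.mp (hE.eq_x z hz l)

theorem IsTrivialization.hasDerivAt_snd {E : ℝ × ℝ → ℂ → Mat n}
    (hE : IsTrivialization a p j O u E) (hz : z ∈ O) (l : ℂ) :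
    HasDerivAt (fun s => E (z.1, s) l)
      (E z l * laxSymbol (Polynomial.aeval (qaSeries a u z) p) j l) z.2 := by
  rw [laxSymbol_aeval_qaSeries]
  exact hasPartialT_iff.mp (hE.eq_t z hz l)

variable {α₁ α₂ : ℂ} {π : Mat n} {σ : ℝ × ℝ → Mat n}

theorem SolvesProjSystem.hasDerivAt_fst (hσ : SolvesProjSystem a p j O u α₁ α₂ π σ)
    (hz : z ∈ O) :
    HasDerivAt (fun s => σ (s, z.2))
      (-∑ k ∈ Finset.range (1 + 1), ⁅coeff (1 - k) (connectionSeries a (u z)), σ z⁆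
        * spectralPencil α₁ α₂ (σ z) ^ k) z.1 := by
  rw [neg_sum_lie_connectionSeries]
  exact hasPartialX_iff.mp (hσ.eq_x z hz)

theorem SolvesProjSystem.hasDerivAt_snd (hσ : SolvesProjSystem a p j O u α₁ α₂ π σ)
    (hz : z ∈ O) :
    HasDerivAt (fun s => σ (z.1, s))
      (-∑ k ∈ Finset.range (j + 1), ⁅coeff (j - k) (Polynomial.aeval (qaSeries a u z) p), σ z⁆
        * spectralPencil α₁ α₂ (σ z) ^ k) z.2 :=
  hasPartialT_iff.mp (hσ.eq_t z hz)

end LaxPair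

section DressedProjection

open PowerSeries Filter
open scoped Topology Matrix.Norms.Operator

variable {n : ℕ} {a : Fin n → ℂ} {p : Polynomial ℂ} {j : ℕ} {O O₁ : Set (ℝ × ℝ)}
  {u : ℝ × ℝ → Mat n} {E : ℝ × ℝ → ℂ → Mat n} {z : ℝ × ℝ} {α₁ α₂ : ℂ} {π : Mat n}

theorem IsTransformedProj.hasDerivAt {𝔸 : Type*} [NormedRing 𝔸] [NormedAlgebra ℂ 𝔸]
    {E : ℝ → ℂ → 𝔸} {π : 𝔸} {σ : ℝ → 𝔸} {s : ℝ} {B : 𝔸⟦X⟧} {j : ℕ}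
    (h : ∀ᶠ r in 𝓝 s, IsTransformedProj (E r α₁) (E r α₂) π (σ r))
    (hE : ∀ l, HasDerivAt (fun r => E r l) (E s l * laxSymbol B j l) s)
    (hσ : DifferentiableAt ℝ σ s) :
    HasDerivAt σ (-∑ k ∈ Finset.range (j + 1),
      ⁅coeff (j - k) B, σ s⁆ * spectralPencil α₁ α₂ (σ s) ^ k) s := by
  rw [neg_sum_lie_mul_spectralPencil_pow h.self_of_nhds.idem,
    ← deriv_eq h (hE α₁) (hE α₂) hσ.hasDerivAt]
  exact hσ.hasDerivAt

theorem isTransformedProj_dressedProj (hπ : IsIdempotentElem π)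
    (h : pullbackRange (E z α₁) π ⊓ pullbackRange (E z α₂) (1 - π) = ⊥) :
    IsTransformedProj (E z α₁) (E z α₂) π (dressedProj E α₁ α₂ π z) := by
  have hσ := IsTransformedProj.of_isUnit hπ ((pullbackRange_inf_eq_bot_iff hπ).mp h)
  rwa [dressedProj, hσ.projMatrix_eq hπ]

theorem IsTrivialization.mono (hE : IsTrivialization a p j O₁ u E) (hO : O ⊆ O₁) :
    IsTrivialization a p j O u E where
  smooth i k := (hE.smooth i k).mono (Set.prod_mono_left hO)
  invertible z hz := hE.invertible z (hO hz)
  eq_x z hz := hE.eq_x z (hO hz)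
  eq_t z hz := hE.eq_t z (hO hz)
  normalized := hE.normalized

theorem IsTrivialization.contDiffOn_slice (hE : IsTrivialization a p j O u E) (l : ℂ) :
    ContDiffOn ℝ ∞ (fun z => E z l) O :=
  (smoothOn_iff.mp hE.smooth).comp (contDiff_prodMk_left l).contDiffOn fun _ hz => ⟨hz, trivial⟩

theorem IsTrivialization.contDiffOn_dressingFrame (hE : IsTrivialization a p j O u E)
    (α₁ α₂ : ℂ) (π : Mat n) :
    ContDiffOn ℝ ∞ (fun z => dressingFrame (E z α₁) (E z α₂) π) O :=
  (contDiffOn_const.mul (hE.contDiffOn_slice α₁)).add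
    (contDiffOn_const.mul (hE.contDiffOn_slice α₂))

theorem IsTrivialization.contDiffOn_dressedProj (hE : IsTrivialization a p j O u E)
    (hπ : IsIdempotentElem π)
    (h : ∀ z ∈ O, pullbackRange (E z α₁) π ⊓ pullbackRange (E z α₂) (1 - π) = ⊥) :
    ContDiffOn ℝ ∞ (dressedProj E α₁ α₂ π) O := by
  have hunit z (hz : z ∈ O) := (pullbackRange_inf_eq_bot_iff hπ).mp (h z hz)
  have hN := hE.contDiffOn_dressingFrame α₁ α₂ π
  refine (((contDiffOn_ringInverse hN hunit).mul (contDiffOn_const (c := π))).mul hN).congr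
    (f₁ := dressedProj E α₁ α₂ π) fun z hz => ?_
  rw [dressedProj, (IsTransformedProj.of_isUnit hπ (hunit z hz)).projMatrix_eq hπ]

theorem IsTrivialization.exists_isConnected_inf_eq_bot (hE : IsTrivialization a p j O u E)
    (hO : IsOpen O) (h0 : (0, 0) ∈ O) (hπ : IsIdempotentElem π) :
    ∃ O' : Set (ℝ × ℝ), IsOpen O' ∧ IsConnected O' ∧ (0, 0) ∈ O' ∧ O' ⊆ O ∧
      ∀ z ∈ O', pullbackRange (E z α₁) π ⊓ pullbackRange (E z α₂) (1 - π) = ⊥ := by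
  have hunit0 : IsUnit (dressingFrame (E (0, 0) α₁) (E (0, 0) α₂) π) := by
    rw [dressingFrame, hE.normalized, hE.normalized, mul_one, mul_one, sub_add_cancel]
    exact isUnit_one
  have hev : ∀ᶠ z in 𝓝 (0, 0), z ∈ O ∧ IsUnit (dressingFrame (E z α₁) (E z α₂) π) :=
    (hO.eventually_mem h0).and
      (((hE.contDiffOn_dressingFrame α₁ α₂ π).continuousOn.continuousAt
        (hO.mem_nhds h0)).eventually (Units.isOpen.eventually_mem hunit0))
  obtain ⟨ε, hε, hball⟩ := Metric.eventually_nhds_iff_ball.mp hev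
  have hmem : (0, 0) ∈ Metric.ball ((0, 0) : ℝ × ℝ) ε := Metric.mem_ball_self hε
  exact ⟨_, Metric.isOpen_ball, ⟨⟨_, hmem⟩, (convex_ball _ _).isPreconnected⟩, hmem,
    fun z hz => (hball z hz).1, fun z hz => (pullbackRange_inf_eq_bot_iff hπ).mpr (hball z hz).2⟩

theorem IsTrivialization.solvesProjSystem_dressedProj (hE : IsTrivialization a p j O u E)
    (hO : IsOpen O) (h0 : (0, 0) ∈ O) (hπ : IsIdempotentElem π)
    (h : ∀ z ∈ O, pullbackRange (E z α₁) π ⊓ pullbackRange (E z α₂) (1 - π) = ⊥) :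
    SolvesProjSystem a p j O u α₁ α₂ π (dressedProj E α₁ α₂ π) := by
  have hσ z (hz : z ∈ O) := isTransformedProj_dressedProj hπ (h z hz)
  have hd z (hz : z ∈ O) : DifferentiableAt ℝ (dressedProj E α₁ α₂ π) z :=
    ((hE.contDiffOn_dressedProj hπ h).contDiffAt (hO.mem_nhds hz)).differentiableAt (by simp)
  refine ⟨fun z hz => ?_, fun z hz => ?_, fun z hz => (hσ z hz).idem, ?_⟩
  · have := IsTransformedProj.hasDerivAt
      ((eventually_mem_slice_fst hO hz).mono fun s hs => hσ _ hs)
      (hE.hasDerivAt_fst hz) (hasDerivAt_slice_fst (hd z hz)).differentiableAt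
    rw [neg_sum_lie_connectionSeries] at this
    exact hasPartialX_iff.mpr this
  · exact hasPartialT_iff.mpr (IsTransformedProj.hasDerivAt
      ((eventually_mem_slice_snd hO hz).mono fun s hs => hσ _ hs)
      (hE.hasDerivAt_snd hz) (hasDerivAt_slice_snd (hd z hz)).differentiableAt)
  · refine ((hσ _ h0).eq_of_mul_eq_zero ?_ ?_).symm
    · rw [hE.normalized, mul_one, hπ.one_sub_mul_self]
    · rw [hE.normalized, mul_one, hπ.mul_one_sub_self]

end DressedProjection

section LinearUniqueness

open Set Filter
open scoped Topology

variable {𝔸 : Type*} [NormedRing 𝔸] [NormedAlgebra ℝ 𝔸]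

theorem eqOn_zero_of_hasDerivAt_mul {Y R : ℝ → 𝔸} {b c s₀ : ℝ} (hs₀ : s₀ ∈ Ioo b c)
    (hY : ∀ s ∈ Ioo b c, HasDerivAt Y (Y s * R s) s) (hR : ContinuousOn R (Icc b c))
    (h0 : Y s₀ = 0) : EqOn Y 0 (Ioo b c) := by
  obtain ⟨K, hK⟩ := isCompact_Icc.exists_bound_of_continuousOn hR
  have hlip s (hs : s ∈ Ioo b c) : LipschitzOnWith K.toNNReal (fun y => y * R s) univ := by
    refine LipschitzOnWith.of_dist_le_mul fun y _ w _ => ?_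
    rw [dist_eq_norm, dist_eq_norm, ← sub_mul, mul_comm]
    refine (norm_mul_le _ _).trans (mul_le_mul_of_nonneg_left ?_ (norm_nonneg _))
    exact (hK s (Ioo_subset_Icc_self hs)).trans (Real.le_coe_toNNReal K)
  refine ODE_solution_unique_of_mem_Ioo hlip hs₀ (fun s hs => ⟨hY s hs, trivial⟩)
    (fun s _ => ⟨by simp, trivial⟩) h0

theorem eqOn_zero_of_hasDerivAt_slice_mul {O : Set (ℝ × ℝ)} (hc : IsPreconnected O)
    (hO : IsOpen O) {M R₁ R₂ : ℝ × ℝ → 𝔸}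
    (hM₁ : ∀ z ∈ O, HasDerivAt (fun s => M (s, z.2)) (M z * R₁ z) z.1)
    (hM₂ : ∀ z ∈ O, HasDerivAt (fun s => M (z.1, s)) (M z * R₂ z) z.2)
    (hR₁ : ∀ z ∈ O, ContinuousAt (fun s => R₁ (s, z.2)) z.1)
    (hR₂ : ∀ z ∈ O, ContinuousAt (fun s => R₂ (z.1, s)) z.2)
    {z₀ : ℝ × ℝ} (hz₀ : z₀ ∈ O) (h0 : M z₀ = 0) : EqOn M 0 O := by
  have hbox {x t r : ℝ} (hr : Icc (x - r) (x + r) ×ˢ Icc (t - r) (t + r) ⊆ O)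
      {y w : ℝ × ℝ} (hy : y ∈ Ioo (x - r) (x + r) ×ˢ Ioo (t - r) (t + r))
      (hw : w ∈ Ioo (x - r) (x + r) ×ˢ Ioo (t - r) (t + r)) (hy0 : M y = 0) : M w = 0 := by
    have hcorner : M (w.1, y.2) = 0 := by
      have hmem s (hs : s ∈ Icc (x - r) (x + r)) : (s, y.2) ∈ O :=
        hr ⟨hs, Ioo_subset_Icc_self hy.2⟩
      exact eqOn_zero_of_hasDerivAt_mul (Y := fun s => M (s, y.2)) hy.1
        (fun s hs => hM₁ _ (hmem s (Ioo_subset_Icc_self hs)))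
        (fun s hs => (hR₁ _ (hmem s hs)).continuousWithinAt) hy0 hw.1
    have hmem s (hs : s ∈ Icc (t - r) (t + r)) : (w.1, s) ∈ O :=
      hr ⟨Ioo_subset_Icc_self hw.1, hs⟩
    exact eqOn_zero_of_hasDerivAt_mul (Y := fun s => M (w.1, s)) hy.2
      (fun s hs => hM₂ _ (hmem s (Ioo_subset_Icc_self hs)))
      (fun s hs => (hR₂ _ (hmem s hs)).continuousWithinAt) hcorner hw.2
  intro z hz
  refine hc.induction₂' (fun y w => M y = 0 → M w = 0) (fun y hy => ?_)
    (fun _ _ _ _ _ _ h h' h0 => h' (h h0)) hz₀ hz h0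
  obtain ⟨r, hr, hsub⟩ := Metric.nhds_basis_closedBall.mem_iff.mp (hO.mem_nhds hy)
  rw [← closedBall_prod_same, Real.closedBall_eq_Icc, Real.closedBall_eq_Icc] at hsub
  have hball {w : ℝ × ℝ} (hw : w ∈ Metric.ball y r) :
      w ∈ Ioo (y.1 - r) (y.1 + r) ×ˢ Ioo (y.2 - r) (y.2 + r) := by
    rwa [← Real.ball_eq_Ioo, ← Real.ball_eq_Ioo, ball_prod_same]
  filter_upwards [mem_nhdsWithin_of_mem_nhds (Metric.ball_mem_nhds y hr)] with w hw
  exact ⟨hbox hsub (hball (Metric.mem_ball_self hr)) (hball hw),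
    hbox hsub (hball hw) (hball (Metric.mem_ball_self hr))⟩

end LinearUniqueness

section ProjectionUniqueness

open PowerSeries
open scoped Matrix.Norms.Operator

/-- The quantity that vanishes exactly at the transformed projection. Along every solution `ρ` of
the projection system it satisfies a homogeneous linear equation. -/
def transformDefect {A : Type*} [Ring A] (A₁ A₂ π ρ : A) : A :=
  (1 - π) * A₁ * ρ + π * A₂ * (1 - ρ)

theorem IsTransformedProj.eq_of_transformDefect_eq_zero {A : Type*} [Ring A] {A₁ A₂ π σ ρ : A}
    (h : IsTransformedProj A₁ A₂ π σ) (hπ : IsIdempotentElem π)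
    (h0 : transformDefect A₁ A₂ π ρ = 0) : ρ = σ := by
  refine h.eq_of_mul_eq_zero ?_ ?_
  · simpa [transformDefect, mul_add, ← mul_assoc, hπ.one_sub.eq, hπ.one_sub_mul_self]
      using congrArg ((1 - π) * ·) h0
  · simpa [transformDefect, mul_add, ← mul_assoc, hπ.eq, hπ.mul_one_sub_self]
      using congrArg (π * ·) h0

theorem hasDerivAt_transformDefect {𝔸 : Type*} [NormedRing 𝔸] [NormedAlgebra ℂ 𝔸]
    {E : ℝ → ℂ → 𝔸} {ρ : ℝ → 𝔸} {s : ℝ} {B : 𝔸⟦X⟧} {j : ℕ} {α₁ α₂ : ℂ}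
    (hE : ∀ l, HasDerivAt (fun r => E r l) (E s l * laxSymbol B j l) s)
    (hid : IsIdempotentElem (ρ s))
    (hρ : HasDerivAt ρ (-∑ k ∈ Finset.range (j + 1),
      ⁅coeff (j - k) B, ρ s⁆ * spectralPencil α₁ α₂ (ρ s) ^ k) s) (π : 𝔸) :
    HasDerivAt (fun r => transformDefect (E r α₁) (E r α₂) π (ρ r))
      (transformDefect (E s α₁) (E s α₂) π (ρ s)
        * (laxSymbol B j α₁ * ρ s + laxSymbol B j α₂ * (1 - ρ s))) s := by
  rw [neg_sum_lie_mul_spectralPencil_pow hid] at hρ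
  refine ((((hE α₁).const_mul (1 - π)).mul hρ).add
    (((hE α₂).const_mul π).mul (hρ.const_sub 1))).congr_deriv ?_
  rw [transformDefect]
  noncomm_ring

variable {n : ℕ} {a : Fin n → ℂ} {p : Polynomial ℂ} {j : ℕ} {O : Set (ℝ × ℝ)}
  {u : ℝ × ℝ → Mat n} {E : ℝ × ℝ → ℂ → Mat n} {α₁ α₂ : ℂ} {π : Mat n} {ρ : ℝ × ℝ → Mat n}

theorem continuousOn_laxSymbol_connectionSeries (hu : ContinuousOn u O) (a : Fin n → ℂ) (l : ℂ) :
    ContinuousOn (fun z => laxSymbol (connectionSeries a (u z)) 1 l) O := by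
  simp only [laxSymbol_connectionSeries]
  exact continuousOn_const.add hu

theorem continuousOn_laxSymbol_aeval_qaSeries (hO : IsOpen O) (hu : ContDiffOn ℝ ∞ u O)
    (a : Fin n → ℂ) (p : Polynomial ℂ) (j : ℕ) (l : ℂ) :
    ContinuousOn (fun z => laxSymbol (Polynomial.aeval (qaSeries a u z) p) j l) O :=
  continuousOn_finsetSum _ fun k _ => ContinuousOn.const_smul (M := ℂ)
    (contDiffOn_Qb hO a p hu (j - k)).continuousOn (l ^ k)

theorem SolvesProjSystem.eqOn_dressedProj (hρ : SolvesProjSystem a p j O u α₁ α₂ π ρ)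
    (hu : ContDiffOn ℝ ∞ u O) (hE : IsTrivialization a p j O u E) (hO : IsOpen O)
    (hc : IsPreconnected O) (h0 : (0, 0) ∈ O) (hπ : IsIdempotentElem π)
    (h : ∀ z ∈ O, pullbackRange (E z α₁) π ⊓ pullbackRange (E z α₂) (1 - π) = ⊥) :
    Set.EqOn ρ (dressedProj E α₁ α₂ π) O := by
  have hG₁ l z (hz : z ∈ O) : ContinuousAt
      (fun s : ℝ => laxSymbol (connectionSeries a (u (s, z.2))) 1 l) z.1 :=
    ((continuousOn_laxSymbol_connectionSeries hu.continuousOn a l).continuousAt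
      (hO.mem_nhds hz)).comp_of_eq (f := fun s : ℝ => (s, z.2)) (by fun_prop) rfl
  have hG₂ l z (hz : z ∈ O) : ContinuousAt
      (fun s : ℝ => laxSymbol (Polynomial.aeval (qaSeries a u (z.1, s)) p) j l) z.2 :=
    ((continuousOn_laxSymbol_aeval_qaSeries hO hu a p j l).continuousAt
      (hO.mem_nhds hz)).comp_of_eq (f := fun s : ℝ => (z.1, s)) (by fun_prop) rfl
  have hdefect := eqOn_zero_of_hasDerivAt_slice_mul hc hO
    (M := fun z => transformDefect (E z α₁) (E z α₂) π (ρ z))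
    (fun z hz => hasDerivAt_transformDefect (ρ := fun s => ρ (s, z.2))
      (hE.hasDerivAt_fst hz) (hρ.idem z hz) (hρ.hasDerivAt_fst hz) π)
    (fun z hz => hasDerivAt_transformDefect (ρ := fun s => ρ (z.1, s))
      (hE.hasDerivAt_snd hz) (hρ.idem z hz) (hρ.hasDerivAt_snd hz) π)
    (fun z hz => ((hG₁ α₁ z hz).mul (hρ.hasDerivAt_fst hz).continuousAt).add
      ((hG₁ α₂ z hz).mul (continuousAt_const.sub (hρ.hasDerivAt_fst hz).continuousAt)))
    (fun z hz => ((hG₂ α₁ z hz).mul (hρ.hasDerivAt_snd hz).continuousAt).add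
      ((hG₂ α₂ z hz).mul (continuousAt_const.sub (hρ.hasDerivAt_snd hz).continuousAt))) h0 ?_
  · exact fun z hz => (isTransformedProj_dressedProj hπ (h z hz)).eq_of_transformDefect_eq_zero hπ
      (hdefect hz)
  · simp [transformDefect, hE.normalized, hρ.initial, hπ.one_sub_mul_self, hπ.mul_one_sub_self]

end ProjectionUniqueness

section DressedMatrix

open PowerSeries Filter
open scoped Topology

section Ring

variable {K A : Type*} [Field K] [Ring A] [Algebra K A] {σ : A} {α₁ α₂ l : K}

theorem smul_one_sub_spectralPencil (α₁ α₂ l : K) (σ : A) :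
    l • 1 - spectralPencil α₁ α₂ σ = (l - α₁) • σ + (l - α₂) • (1 - σ) := by
  rw [spectralPencil]
  module

theorem isUnit_smul_one_sub_spectralPencil (hσ : IsIdempotentElem σ) (h₁ : l ≠ α₁)
    (h₂ : l ≠ α₂) : IsUnit (l • 1 - spectralPencil α₁ α₂ σ) := by
  have h₁' := sub_ne_zero.mpr h₁
  have h₂' := sub_ne_zero.mpr h₂
  rw [smul_one_sub_spectralPencil]
  refine isUnit_iff_exists.mpr ⟨(l - α₁)⁻¹ • σ + (l - α₂)⁻¹ • (1 - σ), ?_, ?_⟩ <;>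
  simp [add_mul, mul_add, hσ.eq, hσ.one_sub.eq, hσ.mul_one_sub_self,
    hσ.one_sub_mul_self, h₁', h₂']

end Ring

section NormedRing

variable {𝔸 : Type*} [NormedRing 𝔸] [NormedAlgebra ℂ 𝔸] {E : ℂ → 𝔸} {α₁ α₂ l : ℂ} {π σ : 𝔸}

/-- The product `h_{α₁,α₂,π} E h_{α₁,α₂,σ}⁻¹` with the removable singularities at `α₁` and `α₂`
filled in: as `(1 - π) E(α₁) σ` and `π E(α₂) (1 - σ)` vanish, divided differences take the place of
the singular quotients. -/
noncomputable def dressedMatrix (E : ℂ → 𝔸) (α₁ α₂ : ℂ) (π σ : 𝔸) (l : ℂ) : 𝔸 :=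
  π * E l * σ + (1 - π) * E l * (1 - σ) + (l - α₁) • (π * dslope E α₂ l * (1 - σ))
    + (l - α₂) • ((1 - π) * dslope E α₁ l * σ)

theorem dressedMatrix_mul_sub (h : IsTransformedProj (E α₁) (E α₂) π σ) (l : ℂ) :
    dressedMatrix E α₁ α₂ π σ l * (l • 1 - spectralPencil α₁ α₂ σ)
      = (l • 1 - spectralPencil α₁ α₂ π) * E l := by
  have h₁ : (l - α₁) • ((1 - π) * dslope E α₁ l * σ) = (1 - π) * E l * σ := by
    rw [← smul_mul_assoc, ← mul_smul_comm, sub_smul_dslope, mul_sub, sub_mul,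
      h.one_sub_mul_mul_self, sub_zero]
  have h₂ : (l - α₂) • (π * dslope E α₂ l * (1 - σ)) = π * E l * (1 - σ) := by
    rw [← smul_mul_assoc, ← mul_smul_comm, sub_smul_dslope, mul_sub π, sub_mul,
      h.mul_mul_one_sub_self, sub_zero]
  have hσ : dressedMatrix E α₁ α₂ π σ l * σ
      = π * E l * σ + (l - α₂) • ((1 - π) * dslope E α₁ l * σ) := by
    simp [dressedMatrix, add_mul, mul_assoc, h.idem.eq, h.idem.one_sub_mul_self]
  have hσ' : dressedMatrix E α₁ α₂ π σ l * (1 - σ)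
      = (1 - π) * E l * (1 - σ) + (l - α₁) • (π * dslope E α₂ l * (1 - σ)) := by
    simp [dressedMatrix, add_mul, mul_assoc, h.idem.one_sub.eq, h.idem.mul_one_sub_self]
  rw [smul_one_sub_spectralPencil, smul_one_sub_spectralPencil, mul_add, mul_smul_comm,
    mul_smul_comm, hσ, hσ', smul_add, smul_add, smul_comm (l - α₁) (l - α₂), h₁,
    smul_comm (l - α₂) (l - α₁), h₂]
  simp only [add_mul, sub_mul, one_mul, smul_mul_assoc, mul_sub, mul_one, smul_sub]
  abel

theorem dressedMatrix_one (hπ : IsIdempotentElem π) (α₁ α₂ l : ℂ) :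
    dressedMatrix (fun _ => 1) α₁ α₂ π π l = 1 := by
  have hdslope (α : ℂ) : dslope (fun _ : ℂ => (1 : 𝔸)) α l = 0 := by
    rcases eq_or_ne l α with rfl | hne
    · simp
    · simp [dslope_of_ne _ hne, slope_def_module]
  simp [dressedMatrix, hdslope, hπ.eq, hπ.one_sub.eq]

theorem differentiable_dressedMatrix [CompleteSpace 𝔸] (hE : Differentiable ℂ E)
    (α₁ α₂ : ℂ) (π σ : 𝔸) : Differentiable ℂ (dressedMatrix E α₁ α₂ π σ) :=
  ((((hE.const_mul π).mul_const σ).add ((hE.const_mul _).mul_const _)).add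
    ((differentiable_id.sub_const α₁).smul
      (((differentiable_dslope hE α₂).const_mul π).mul_const _))).add
    ((differentiable_id.sub_const α₂).smul
      (((differentiable_dslope hE α₁).const_mul _).mul_const σ))

/-- Differentiate `E' (λ - τ) = (λ - τ₀) E`, cancel `λ - τ` for `λ ≠ α₁, α₂`, and use that both
sides of the resulting identity are continuous in `λ`. -/
theorem hasDerivAt_dressedMatrix_eq [CompleteSpace 𝔸] {E : ℝ → ℂ → 𝔸} {σ : ℝ → 𝔸} {s : ℝ}
    {B B' : 𝔸⟦X⟧} {j : ℕ} {D : ℂ → 𝔸}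
    (h : ∀ᶠ r in 𝓝 s, IsTransformedProj (E r α₁) (E r α₂) π (σ r))
    (hE : ∀ l, HasDerivAt (fun r => E r l) (E s l * laxSymbol B j l) s)
    (hσ : HasDerivAt σ (-∑ k ∈ Finset.range (j + 1),
      ⁅coeff (j - k) B, σ s⁆ * spectralPencil α₁ α₂ (σ s) ^ k) s)
    (hB : IsGaugeRelated j (spectralPencil α₁ α₂ (σ s)) B B')
    (hEl : Differentiable ℂ (E s)) (hD : Continuous D)
    (hE' : ∀ l, HasDerivAt (fun r => dressedMatrix (E r) α₁ α₂ π (σ r) l) (D l) s) :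
    D = fun l => dressedMatrix (E s) α₁ α₂ π (σ s) l * laxSymbol B' j l := by
  have hcont : Continuous fun l =>
      dressedMatrix (E s) α₁ α₂ π (σ s) l * laxSymbol B' j l :=
    (differentiable_dressedMatrix hEl α₁ α₂ π (σ s)).continuous.mul <|
      continuous_finsetSum _ fun k _ => (continuous_pow k).smul continuous_const
  refine Continuous.ext_on ((Set.toFinite {α₁, α₂}).countable.dense_compl ℝ) hD hcont fun l hl => ?_
  have hl' : l ≠ α₁ ∧ l ≠ α₂ := by simpa using hl
  have hτ : HasDerivAt (fun r => l • 1 - spectralPencil α₁ α₂ (σ r))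
      (-(laxSymbol B' j l * (l • 1 - spectralPencil α₁ α₂ (σ s))
        - (l • 1 - spectralPencil α₁ α₂ (σ s)) * laxSymbol B j l)) s := by
    rw [← hB.smul_neg_sum_lie_mul_spectralPencil_pow l]
    exact ((hσ.const_smul (α₁ - α₂)).const_add _).const_sub _
  have hcomm := ((hE' l).mul hτ).unique <| ((hE l).const_mul
    (l • 1 - spectralPencil α₁ α₂ π)).congr_of_eventuallyEq <|
      h.mono fun r hr => dressedMatrix_mul_sub hr l
  rw [← mul_assoc, ← dressedMatrix_mul_sub h.self_of_nhds l] at hcomm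
  refine (isUnit_smul_one_sub_spectralPencil h.self_of_nhds.idem hl'.1 hl'.2).mul_left_injective ?_
  linear_combination (norm := noncomm_ring) hcomm

end NormedRing

end DressedMatrix

section DressedTrivialization

open PowerSeries Filter
open scoped Topology Matrix.Norms.Operator

section LeftRegular

variable {𝔸 : Type*} [NormedRing 𝔸] [NormedAlgebra ℂ 𝔸] {E : ℂ → 𝔸} {α₁ α₂ : ℂ} {π σ : 𝔸}

theorem isLeftRegular_dressedMatrix_left (h : IsTransformedProj (E α₁) (E α₂) π σ)
    (hπ : IsIdempotentElem π) (hE : IsUnit (E α₁)) :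
    IsLeftRegular (dressedMatrix E α₁ α₂ π σ α₁) := by
  refine isLeftRegular_of_non_zero_divisor _ fun Y hY => ?_
  have hπY : π * E α₁ * σ * Y = 0 := by
    simpa [dressedMatrix, mul_add, add_mul, ← mul_assoc, hπ.eq, hπ.mul_one_sub_self]
      using congrArg (π * ·) hY
  have hEσY : E α₁ * (σ * Y) = 0 := by
    linear_combination (norm := noncomm_ring) hπY + h.one_sub_mul_mul_self * Y
  have hσY : σ * Y = 0 := hE.mul_right_eq_zero.mp hEσY
  have hY' : (1 - π) * E α₁ * Y = 0 := by
    simpa [dressedMatrix, mul_add, add_mul, mul_assoc, sub_mul _ _ Y, hσY] using hY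
  rw [← h.mul_eq_of_one_sub_mul_mul_eq_zero hY', hσY]

theorem isLeftRegular_dressedMatrix_right (h : IsTransformedProj (E α₁) (E α₂) π σ)
    (hπ : IsIdempotentElem π) (hE : IsUnit (E α₂)) :
    IsLeftRegular (dressedMatrix E α₁ α₂ π σ α₂) := by
  refine isLeftRegular_of_non_zero_divisor _ fun Y hY => ?_
  have hπY : (1 - π) * E α₂ * (1 - σ) * Y = 0 := by
    simpa [dressedMatrix, mul_add, add_mul, ← mul_assoc, hπ.one_sub.eq, hπ.one_sub_mul_self]
      using congrArg ((1 - π) * ·) hY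
  have hEσY : E α₂ * ((1 - σ) * Y) = 0 := by
    linear_combination (norm := noncomm_ring) hπY + h.mul_mul_one_sub_self * Y
  have hσY : (1 - σ) * Y = 0 := hE.mul_right_eq_zero.mp hEσY
  have hσY' : σ * Y = Y := (sub_eq_zero.mp (by rwa [sub_mul, one_mul] at hσY)).symm
  have hY' : π * E α₂ * Y = 0 := by
    simpa [dressedMatrix, add_mul, mul_assoc, hσY, hσY'] using hY
  rw [← hσY', h.mul_eq_zero_of_mul_mul_eq_zero hY']

theorem isLeftRegular_dressedMatrix (h : IsTransformedProj (E α₁) (E α₂) π σ)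
    (hπ : IsIdempotentElem π) (hE : ∀ l, IsUnit (E l)) (l : ℂ) :
    IsLeftRegular (dressedMatrix E α₁ α₂ π σ l) := by
  rcases eq_or_ne l α₁ with rfl | h₁
  · exact isLeftRegular_dressedMatrix_left h hπ (hE _)
  rcases eq_or_ne l α₂ with rfl | h₂
  · exact isLeftRegular_dressedMatrix_right h hπ (hE _)
  have hτ := isUnit_smul_one_sub_spectralPencil h.idem h₁ h₂
  have hunit : IsUnit (dressedMatrix E α₁ α₂ π σ l * (l • 1 - spectralPencil α₁ α₂ σ)) := by
    rw [dressedMatrix_mul_sub h]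
    exact (isUnit_smul_one_sub_spectralPencil hπ h₁ h₂).mul (hE l)
  exact ((Units.isUnit_mul_units _ hτ.unit).mp hunit).isRegular.left

end LeftRegular

section Smooth

variable {H V 𝔸 : Type*} [NormedAddCommGroup H] [NormedSpace ℝ H] [NormedAddCommGroup V]
  [NormedSpace ℝ V] [NormedRing 𝔸] [NormedAlgebra ℂ 𝔸] {O : Set H}

theorem continuous_fderiv_slice {F : H × ℂ → V} (hO : IsOpen O)
    (hF : ContDiffOn ℝ ∞ F (O ×ˢ Set.univ)) {y : H} (hy : y ∈ O) :
    Continuous fun l => fderiv ℝ (fun w => F (w, l)) y := by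
  refine continuous_iff_continuousAt.mpr fun l => ?_
  have hFl : ContDiffAt ℝ ∞ (Function.uncurry fun l w => F (w, l)) (l, y) :=
    (hF.contDiffAt ((hO.prod isOpen_univ).mem_nhds ⟨hy, trivial⟩)).comp (l, y)
      (contDiff_snd.prodMk contDiff_fst).contDiffAt
  exact (hFl.fderiv (m := 0) (g := fun _ => y) contDiffAt_const (by simp)).continuousAt

theorem contDiffOn_dressedMatrix [CompleteSpace 𝔸] {E : H → ℂ → 𝔸} {σ : H → 𝔸} (hO : IsOpen O)
    (hE : ContDiffOn ℝ ∞ (fun q : H × ℂ => E q.1 q.2) (O ×ˢ Set.univ))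
    (hEl : ∀ y ∈ O, Differentiable ℂ (E y)) (hσ : ContDiffOn ℝ ∞ σ O) (α₁ α₂ : ℂ) (π : 𝔸) :
    ContDiffOn ℝ ∞ (fun q : H × ℂ => dressedMatrix (E q.1) α₁ α₂ π (σ q.1) q.2)
      (O ×ˢ Set.univ) := by
  have hσ' : ContDiffOn ℝ ∞ (fun q : H × ℂ => σ q.1) (O ×ˢ Set.univ) :=
    hσ.comp contDiffOn_fst fun q hq => hq.1
  have hl (α : ℂ) : ContDiffOn ℝ ∞ (fun q : H × ℂ => q.2 - α) (O ×ˢ Set.univ) :=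
    contDiffOn_snd.sub contDiffOn_const
  have hσ'' := contDiffOn_const (c := (1 : 𝔸)) |>.sub hσ'
  have hdslope := contDiffOn_dslope hO hE hEl
  exact ((((contDiffOn_const (c := π)).mul hE).mul hσ').add
    (((contDiffOn_const (c := 1 - π)).mul hE).mul hσ'')).add
      ((hl α₁).smul (((contDiffOn_const (c := π)).mul (hdslope α₂)).mul hσ'')) |>.add
      ((hl α₂).smul (((contDiffOn_const (c := 1 - π)).mul (hdslope α₁)).mul hσ'))

end Smooth

variable {n : ℕ} {a : Fin n → ℂ} {p : Polynomial ℂ} {j : ℕ} {O : Set (ℝ × ℝ)}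
  {u : ℝ × ℝ → Mat n} {E : ℝ × ℝ → ℂ → Mat n} {α₁ α₂ : ℂ} {π : Mat n} {σ : ℝ × ℝ → Mat n}
  {z : ℝ × ℝ}

/-- The transformed solution `ũ = u + (α₁ - α₂) [a, σ]`. -/
def dressedPotential (a : Fin n → ℂ) (u : ℝ × ℝ → Mat n) (α₁ α₂ : ℂ) (σ : ℝ × ℝ → Mat n)
    (z : ℝ × ℝ) : Mat n :=
  u z + (α₁ - α₂) • ⁅Matrix.diagonal a, σ z⁆

theorem contDiffOn_dressedPotential (a : Fin n → ℂ) (hu : ContDiffOn ℝ ∞ u O)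
    (hσ : ContDiffOn ℝ ∞ σ O) (α₁ α₂ : ℂ) :
    ContDiffOn ℝ ∞ (dressedPotential a u α₁ α₂ σ) O :=
  hu.add (((contDiffOn_const.mul hσ).sub (hσ.mul contDiffOn_const)).const_smul (α₁ - α₂))

theorem isGaugeRelated_connectionSeries_dressedPotential (a : Fin n → ℂ) (u σ : ℝ × ℝ → Mat n)
    (α₁ α₂ : ℂ) (z : ℝ × ℝ) :
    IsGaugeRelated 1 (spectralPencil α₁ α₂ (σ z)) (connectionSeries a (u z))
      (connectionSeries a (dressedPotential a u α₁ α₂ σ z)) := by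
  have := isGaugeRelated_connectionSeries a (u z) (spectralPencil α₁ α₂ (σ z))
  rwa [lie_spectralPencil] at this

theorem SolvesProjSystem.isGaugeRelated_aeval_qaSeries
    (hσ : SolvesProjSystem a p j O u α₁ α₂ π σ) (hO : IsOpen O) (hu : ContDiffOn ℝ ∞ u O)
    (hσs : ContDiffOn ℝ ∞ σ O) (hz : z ∈ O) :
    IsGaugeRelated j (spectralPencil α₁ α₂ (σ z)) (Polynomial.aeval (qaSeries a u z) p)
      (Polynomial.aeval (qaSeries a (dressedPotential a u α₁ α₂ σ) z) p) := by
  have hτs : ContDiffOn ℝ ∞ (fun z => spectralPencil α₁ α₂ (σ z)) O :=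
    contDiffOn_const.add (hσs.const_smul (α₁ - α₂))
  have hτ z (hz : z ∈ O) : HasPartialX (fun z => spectralPencil α₁ α₂ (σ z))
      (-⁅u z, spectralPencil α₁ α₂ (σ z)⁆
        - ⁅Matrix.diagonal a, spectralPencil α₁ α₂ (σ z)⁆ * spectralPencil α₁ α₂ (σ z)) z := by
    have := ((hasPartialX_iff.mp (hσ.eq_x z hz)).const_smul (α₁ - α₂)).const_add (α₂ • 1)
    rw [smul_sub, smul_neg, ← smul_mul_assoc, ← lie_spectralPencil, ← lie_spectralPencil] at this
    exact hasPartialX_iff.mpr this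
  have hsemi := semiconjBy_gaugeSeries_aeval_qaSeries hO a p hu hτs hτ hz
  simp only [lie_spectralPencil] at hsemi
  exact isGaugeRelated_of_semiconjBy hsemi j

theorem IsTrivialization.dressed (hE : IsTrivialization a p j O u E) (hO : IsOpen O)
    (hu : ContDiffOn ℝ ∞ u O) (hEl : ∀ z ∈ O, Differentiable ℂ (E z))
    (hπ : IsIdempotentElem π) (h : ∀ z ∈ O, IsTransformedProj (E z α₁) (E z α₂) π (σ z))
    (hσs : ContDiffOn ℝ ∞ σ O) (hσ : SolvesProjSystem a p j O u α₁ α₂ π σ) :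
    IsTrivialization a p j O (dressedPotential a u α₁ α₂ σ)
      (fun z => dressedMatrix (E z) α₁ α₂ π (σ z)) := by
  have hs := contDiffOn_dressedMatrix hO (smoothOn_iff.mp hE.smooth) hEl hσs α₁ α₂ π
  have hcont {z : ℝ × ℝ} (hz : z ∈ O) := continuous_fderiv_slice hO hs hz
  have hd {z : ℝ × ℝ} (hz : z ∈ O) l :
      DifferentiableAt ℝ (fun w => dressedMatrix (E w) α₁ α₂ π (σ w) l) z :=
    ((hs.contDiffAt ((hO.prod isOpen_univ).mem_nhds ⟨hz, trivial⟩)).comp z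
      (contDiff_prodMk_left l).contDiffAt).differentiableAt (by simp)
  refine ⟨smoothOn_iff.mpr hs, fun z hz l => ?_, fun z hz l => ?_, fun z hz l => ?_, fun l => ?_⟩
  · exact IsArtinianRing.isUnit_iff_isLeftRegular.mpr
      (isLeftRegular_dressedMatrix (h z hz) hπ (hE.invertible z hz) l)
  · have hD := hasDerivAt_dressedMatrix_eq
      ((eventually_mem_slice_fst hO hz).mono fun s hs => h _ hs) (hE.hasDerivAt_fst hz)
      (hσ.hasDerivAt_fst hz) (isGaugeRelated_connectionSeries_dressedPotential a u σ α₁ α₂ z)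
      (hEl z hz) ((hcont hz).clm_apply continuous_const) fun l => hasDerivAt_slice_fst (hd hz l)
    rw [← laxSymbol_connectionSeries, ← congrFun hD l]
    exact hasPartialX_iff.mpr (hasDerivAt_slice_fst (hd hz l))
  · have hD := hasDerivAt_dressedMatrix_eq
      ((eventually_mem_slice_snd hO hz).mono fun s hs => h _ hs) (hE.hasDerivAt_snd hz)
      (hσ.hasDerivAt_snd hz) (hσ.isGaugeRelated_aeval_qaSeries hO hu hσs hz)
      (hEl z hz) ((hcont hz).clm_apply continuous_const) fun l => hasDerivAt_slice_snd (hd hz l)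
    rw [← laxSymbol_aeval_qaSeries, ← congrFun hD l]
    exact hasPartialT_iff.mpr (hasDerivAt_slice_snd (hd hz l))
  · rw [hσ.initial, funext hE.normalized]
    exact dressedMatrix_one hπ α₁ α₂ l

end DressedTrivialization

section ZeroCurvature

open Filter PowerSeries
open scoped Topology Matrix.Norms.Operator

theorem mixed_partial_eq {V : Type*} [NormedAddCommGroup V] [NormedSpace ℝ V]
    {O : Set (ℝ × ℝ)} {f fx ft : ℝ × ℝ → V} {z : ℝ × ℝ} {D D' : V} (hO : IsOpen O)
    (hf : ContDiffOn ℝ ∞ f O) (hfx : ∀ w ∈ O, HasDerivAt (fun s => f (s, w.2)) (fx w) w.1)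
    (hft : ∀ w ∈ O, HasDerivAt (fun s => f (w.1, s)) (ft w) w.2) (hz : z ∈ O)
    (hD : HasDerivAt (fun s => fx (z.1, s)) D z.2)
    (hD' : HasDerivAt (fun s => ft (s, z.2)) D' z.1) : D = D' := by
  have hd w (hw : w ∈ O) : DifferentiableAt ℝ f w :=
    (hf.contDiffAt (hO.mem_nhds hw)).differentiableAt (by simp)
  have hd2 : DifferentiableAt ℝ (fderiv ℝ f) z :=
    ((hf.fderiv_of_isOpen hO (m := ∞) (by simp)).contDiffAt (hO.mem_nhds hz)).differentiableAt
      (by simp)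
  have hx : D = fderiv ℝ (fderiv ℝ f) z (0, 1) (1, 0) := by
    have := (hasDerivAt_slice_snd hd2).clm_apply (hasDerivAt_const z.2 ((1, 0) : ℝ × ℝ))
    rw [map_zero, add_zero] at this
    exact (hD.congr_of_eventuallyEq ((eventually_mem_slice_snd hO hz).mono fun s hs =>
      (hasDerivAt_slice_fst (hd _ hs)).unique (hfx _ hs))).unique this
  have ht : D' = fderiv ℝ (fderiv ℝ f) z (1, 0) (0, 1) := by
    have := (hasDerivAt_slice_fst hd2).clm_apply (hasDerivAt_const z.1 ((0, 1) : ℝ × ℝ))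
    rw [map_zero, add_zero] at this
    exact (hD'.congr_of_eventuallyEq ((eventually_mem_slice_fst hO hz).mono fun s hs =>
      (hasDerivAt_slice_snd (hd _ hs)).unique (hft _ hs))).unique this
  have hsymm : IsSymmSndFDerivAt ℝ f z :=
    (hf.contDiffAt (hO.mem_nhds hz)).isSymmSndFDerivAt
      (by simpa using WithTop.coe_le_coe.mpr (le_top : (2 : ℕ∞) ≤ ⊤))
  rw [hx, ht, hsymm.eq]

theorem eq_add_lie_of_compatible {𝔸 : Type*} [NormedRing 𝔸] [NormedAlgebra ℝ 𝔸]
    {O : Set (ℝ × ℝ)} {V A B : ℝ × ℝ → 𝔸} {z : ℝ × ℝ} {A' B' : 𝔸} (hO : IsOpen O)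
    (hV : ContDiffOn ℝ ∞ V O)
    (hVx : ∀ w ∈ O, HasDerivAt (fun s => V (s, w.2)) (V w * A w) w.1)
    (hVt : ∀ w ∈ O, HasDerivAt (fun s => V (w.1, s)) (V w * B w) w.2) (hz : z ∈ O)
    (hunit : IsUnit (V z)) (hA : HasDerivAt (fun s => A (z.1, s)) A' z.2)
    (hB : HasDerivAt (fun s => B (s, z.2)) B' z.1) : A' = B' + ⁅A z, B z⁆ := by
  have hmixed := mixed_partial_eq hO hV hVx hVt hz ((hVt z hz).mul hA) ((hVx z hz).mul hB)
  refine hunit.mul_left_cancel ?_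
  rw [Ring.lie_def]
  linear_combination (norm := noncomm_ring) hmixed

variable {n : ℕ} {a : Fin n → ℂ} {p : Polynomial ℂ} {j : ℕ} {O : Set (ℝ × ℝ)}
  {u : ℝ × ℝ → Mat n} {E : ℝ × ℝ → ℂ → Mat n}

/-- The flow is the zero-curvature condition at `λ = 0`. -/
theorem IsTrivialization.isLocalSolution (hE : IsTrivialization a p j O u E) (hO : IsOpen O)
    (hu : ContDiffOn ℝ ∞ u O) (hperp : ∀ z ∈ O, u z ∈ slPerp a) :
    IsLocalSolution a p j O u where
  smooth := smoothOn_iff.mpr hu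
  mem_perp := hperp
  flow z hz := by
    have hd {f : ℝ × ℝ → Mat n} (hf : ContDiffOn ℝ ∞ f O) : DifferentiableAt ℝ f z :=
      (hf.contDiffAt (hO.mem_nhds hz)).differentiableAt (by simp)
    have hut := hasDerivAt_slice_snd (hd hu)
    have hQx := hasDerivAt_slice_fst (hd (contDiffOn_Qb hO a p hu j))
    have hEx w (hw : w ∈ O) : HasDerivAt (fun s => E (s, w.2) 0) (E w 0 * u w) w.1 := by
      have := hasPartialX_iff.mp (hE.eq_x w hw 0)
      rwa [zero_smul, zero_add] at this
    have hEt w (hw : w ∈ O) :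
        HasDerivAt (fun s => E (w.1, s) 0) (E w 0 * Qb a p u j w) w.2 := by
      have := hE.hasDerivAt_snd hw 0
      rwa [laxSymbol_apply_zero] at this
    rw [(hasPartialX_iff.mpr hQx).partialX_eq, ← eq_add_lie_of_compatible hO
      (hE.contDiffOn_slice 0) hEx hEt hz (hE.invertible z hz 0) hut hQx]
    exact hasPartialT_iff.mpr hut

theorem lie_diagonal_mem_slPerp (a : Fin n → ℂ) (B : Mat n) :
    ⁅Matrix.diagonal a, B⁆ ∈ slPerp a := by
  refine ⟨by rw [Ring.lie_def, Matrix.trace_sub, Matrix.trace_mul_comm, sub_self], ?_⟩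
  rintro w ⟨-, hw⟩
  rw [Ring.lie_def, sub_eq_zero] at hw
  rw [Ring.lie_def, mul_sub, Matrix.trace_sub, ← mul_assoc, ← hw, ← mul_assoc,
    Matrix.trace_mul_comm (w * B), ← mul_assoc, sub_self]

theorem add_smul_mem_slPerp {y w : Mat n} (hy : y ∈ slPerp a) (hw : w ∈ slPerp a) (c : ℂ) :
    y + c • w ∈ slPerp a := by
  refine ⟨by simp [hy.1, hw.1], fun v hv => ?_⟩
  rw [mul_add, mul_smul_comm, Matrix.trace_add, Matrix.trace_smul, hy.2 v hv, hw.2 v hv, smul_zero,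
    add_zero]

end ZeroCurvature

section AsymptoticExpansion

open Filter Asymptotics Bornology
open scoped Topology Matrix.Norms.Operator

variable {n : ℕ} {O K : Set (ℝ × ℝ)} {Γ : Set ℂ} {m m' : ℝ × ℝ → ℂ → Mat n}
  {c c' : ℕ → ℝ × ℝ → Mat n}

/-- The filter of points `(λ, z)` for which `λ ∉ Γ` tends to `∞` while `z` ranges over `K`. -/
noncomputable def nhdsInfty (Γ : Set ℂ) (K : Set (ℝ × ℝ)) : Filter (ℂ × ℝ × ℝ) :=
  (cobounded ℂ ⊓ 𝓟 Γᶜ) ×ˢ 𝓟 K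

theorem eventually_nhdsInfty_iff {P : ℂ × ℝ × ℝ → Prop} :
    (∀ᶠ q in nhdsInfty Γ K, P q) ↔ ∃ R : ℝ, ∀ z ∈ K, ∀ l ∉ Γ, R ≤ ‖l‖ → P (l, z) := by
  rw [nhdsInfty, eventually_prod_principal_iff, eventually_inf_principal,
    hasBasis_cobounded_norm.eventually_iff]
  exact ⟨fun ⟨R, _, h⟩ => ⟨R, fun z hz l hl hR => h hR hl z hz⟩,
    fun ⟨R, h⟩ => ⟨R, trivial, fun l hR hl z hz => h z hz l hl hR⟩⟩

theorem eventually_nhdsInfty_ne (Γ : Set ℂ) (K : Set (ℝ × ℝ)) (α : ℂ) :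
    ∀ᶠ q in nhdsInfty Γ K, q.1 ≠ α :=
  eventually_nhdsInfty_iff.mpr ⟨‖α‖ + 1, fun _ _ l _ hl hα => by
    subst hα
    linarith⟩

theorem eventually_nhdsInfty_mem (Γ : Set ℂ) (K : Set (ℝ × ℝ)) :
    ∀ᶠ q in nhdsInfty Γ K, q.2 ∈ K :=
  eventually_nhdsInfty_iff.mpr ⟨0, fun _ hz _ _ _ => hz⟩

theorem isBigO_inv_sub_nhdsInfty (Γ : Set ℂ) (K : Set (ℝ × ℝ)) (α : ℂ) :
    (fun q : ℂ × ℝ × ℝ => (q.1 - α)⁻¹) =O[nhdsInfty Γ K] fun _ => (1 : ℝ) := by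
  refine .of_bound 1 (eventually_nhdsInfty_iff.mpr ⟨‖α‖ + 1, fun _ _ l _ hl => ?_⟩)
  have : 1 ≤ ‖l - α‖ := by linarith [norm_sub_norm_le l α]
  simpa using inv_le_one_of_one_le₀ this

theorem isBigO_one_nhdsInfty {B : ℝ × ℝ → Mat n} (hK : IsCompact K) (hB : ContinuousOn B K) :
    (fun q : ℂ × ℝ × ℝ => B q.2) =O[nhdsInfty Γ K] fun _ => (1 : ℝ) := by
  obtain ⟨C, hC⟩ := hK.exists_bound_of_continuousOn hB
  exact .of_bound C (eventually_nhdsInfty_iff.mpr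
    ⟨0, fun z hz _ _ _ => by simpa using hC z hz⟩)

/-- The error of the partial sum of order `N` of the asymptotic series `m ∼ ∑ c_r λ⁻ʳ`. -/
noncomputable def expansionError (m : ℝ × ℝ → ℂ → Mat n) (c : ℕ → ℝ × ℝ → Mat n) (N : ℕ)
    (q : ℂ × ℝ × ℝ) : Mat n :=
  m q.2 q.1 - ∑ r ∈ Finset.range N, (q.1 ^ r)⁻¹ • c r q.2

theorem isBigO_matrix_iff {ι : Type*} {l : Filter ι} {f : ι → Mat n} {g : ι → ℝ} :
    f =O[l] g ↔ ∃ C, ∀ᶠ q in l, ∀ i k, ‖f q i k‖ ≤ C * ‖g q‖ := by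
  let e : Mat n ≃L[ℝ] (Fin n → Fin n → ℂ) :=
    (Matrix.ofLinearEquiv ℝ).toContinuousLinearEquiv.symm
  constructor
  · intro h
    obtain ⟨C, hC⟩ := ((e.isBigO_comp f l).trans h).bound
    exact ⟨C, hC.mono fun q hq i k =>
      (norm_le_pi_norm (e (f q) i) k).trans ((norm_le_pi_norm (e (f q)) i).trans hq)⟩
  · rintro ⟨C, hC⟩
    refine (e.isBigO_comp_rev f l).trans (isBigO_pi.mpr fun i => isBigO_pi.mpr fun k => ?_)
    exact .of_bound C (hC.mono fun q hq => hq i k)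

theorem hasExpansionAtInfty_iff : HasExpansionAtInfty O Γ m c ↔ ∀ N, ∀ K ⊆ O, IsCompact K →
    expansionError m c (N + 1) =O[nhdsInfty Γ K] fun q => ‖q.1 ^ (N + 1)‖⁻¹ := by
  refine forall_congr' fun N => forall₃_congr fun K _ _ => ?_
  simp only [isBigO_matrix_iff, eventually_nhdsInfty_iff, expansionError, norm_inv, norm_norm,
    norm_pow]

theorem HasExpansionAtInfty.isBigO (h : HasExpansionAtInfty O Γ m c)
    (hc : ContinuousOn (c 0) O) (N : ℕ) (hKO : K ⊆ O) (hK : IsCompact K) :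
    expansionError m c N =O[nhdsInfty Γ K] fun q => ‖q.1 ^ N‖⁻¹ := by
  rcases N with _ | N
  · have h1 := hasExpansionAtInfty_iff.mp h 0 K hKO hK
    have h0 := isBigO_one_nhdsInfty (Γ := Γ) hK (hc.mono hKO)
    have hinv : (fun q : ℂ × ℝ × ℝ => ‖q.1 ^ (0 + 1)‖⁻¹) =O[nhdsInfty Γ K] fun _ => (1 : ℝ) := by
      simpa using (isBigO_inv_sub_nhdsInfty Γ K 0).norm_left
    refine ((h1.trans hinv).add h0).congr (fun q => ?_) fun q => by simp
    simp [expansionError]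
  · exact hasExpansionAtInfty_iff.mp h N K hKO hK

theorem HasExpansionAtInfty.mono {O' : Set (ℝ × ℝ)} (h : HasExpansionAtInfty O Γ m c)
    (hO : O' ⊆ O) : HasExpansionAtInfty O' Γ m c :=
  fun N K hK => h N K (hK.trans hO)

theorem HasExpansionAtInfty.add (h : HasExpansionAtInfty O Γ m c)
    (h' : HasExpansionAtInfty O Γ m' c') :
    HasExpansionAtInfty O Γ (fun z l => m z l + m' z l) (fun r z => c r z + c' r z) := by
  refine hasExpansionAtInfty_iff.mpr fun N K hKO hK => ?_
  refine ((hasExpansionAtInfty_iff.mp h N K hKO hK).add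
    (hasExpansionAtInfty_iff.mp h' N K hKO hK)).congr_left fun q => ?_
  simp only [expansionError, smul_add, Finset.sum_add_distrib]
  abel

theorem HasExpansionAtInfty.mul_right (h : HasExpansionAtInfty O Γ m c) {B : ℝ × ℝ → Mat n}
    (hB : ContinuousOn B O) :
    HasExpansionAtInfty O Γ (fun z l => m z l * B z) (fun r z => c r z * B z) := by
  refine hasExpansionAtInfty_iff.mpr fun N K hKO hK => ?_
  refine ((hasExpansionAtInfty_iff.mp h N K hKO hK).mul
    (isBigO_one_nhdsInfty hK (hB.mono hKO))).congr (fun q => ?_) fun q => mul_one _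
  simp only [expansionError, sub_mul, Finset.sum_mul, smul_mul_assoc]

theorem HasExpansionAtInfty.congr (h : HasExpansionAtInfty O Γ m c)
    (hm : ∀ K ⊆ O, ∀ᶠ q in nhdsInfty Γ K, m q.2 q.1 = m' q.2 q.1) :
    HasExpansionAtInfty O Γ m' c := by
  refine hasExpansionAtInfty_iff.mpr fun N K hKO hK => ?_
  refine (hasExpansionAtInfty_iff.mp h N K hKO hK).congr' ((hm K hKO).mono fun q hq => ?_) .rfl
  rw [expansionError, expansionError, hq]

/-- The coefficients of the expansion of `(λ - α)⁻¹ m`, where `c` are those of `m`: by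
`(λ - α)⁻¹ m = λ⁻¹ (m + α (λ - α)⁻¹ m)` each is obtained from the preceding one. -/
def divCoeff (c : ℕ → ℝ × ℝ → Mat n) (α : ℂ) : ℕ → ℝ × ℝ → Mat n
  | 0 => fun _ => 0
  | r + 1 => fun z => c r z + α • divCoeff c α r z

theorem contDiffOn_divCoeff (hc : ∀ r, ContDiffOn ℝ ∞ (c r) O) (α : ℂ) (r : ℕ) :
    ContDiffOn ℝ ∞ (divCoeff c α r) O := by
  induction r with
  | zero => exact contDiffOn_const
  | succ r ih => exact (hc r).add (ih.const_smul α)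

theorem expansionError_div_sub {α : ℂ} (N : ℕ) {q : ℂ × ℝ × ℝ} (h0 : q.1 ≠ 0) (hα : q.1 ≠ α) :
    expansionError (fun z l => (l - α)⁻¹ • m z l) (divCoeff c α) (N + 1) q
      = q.1⁻¹ • (expansionError m c N q
        + α • expansionError (fun z l => (l - α)⁻¹ • m z l) (divCoeff c α) N q) := by
  have hsum : ∑ r ∈ Finset.range (N + 1), (q.1 ^ r)⁻¹ • divCoeff c α r q.2
      = q.1⁻¹ • (∑ r ∈ Finset.range N, (q.1 ^ r)⁻¹ • c r q.2
        + α • ∑ r ∈ Finset.range N, (q.1 ^ r)⁻¹ • divCoeff c α r q.2) := by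
    rw [Finset.sum_range_succ', Finset.smul_sum, ← Finset.sum_add_distrib, Finset.smul_sum]
    simp only [divCoeff, smul_zero, add_zero]
    refine Finset.sum_congr rfl fun r _ => ?_
    rw [pow_succ', mul_inv, mul_smul, smul_add, smul_comm α]
  have hdiv : (q.1 - α)⁻¹ • m q.2 q.1
      = q.1⁻¹ • (m q.2 q.1 + α • (q.1 - α)⁻¹ • m q.2 q.1) := by
    have := sub_ne_zero.mpr hα
    match_scalars
    field_simp
    ring
  rw [expansionError, hsum, hdiv, ← smul_sub, expansionError, expansionError, smul_sub α]
  congr 1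
  abel

theorem HasExpansionAtInfty.div_sub (h : HasExpansionAtInfty O Γ m c)
    (hc : ContinuousOn (c 0) O) (α : ℂ) :
    HasExpansionAtInfty O Γ (fun z l => (l - α)⁻¹ • m z l) (divCoeff c α) := by
  suffices hdiv : ∀ N, ∀ K ⊆ O, IsCompact K →
      expansionError (fun z l => (l - α)⁻¹ • m z l) (divCoeff c α) N
        =O[nhdsInfty Γ K] fun q => ‖q.1 ^ N‖⁻¹ from
    hasExpansionAtInfty_iff.mpr fun N => hdiv (N + 1)
  intro N K hKO hK
  induction N with
  | zero =>
    refine ((isBigO_inv_sub_nhdsInfty Γ K α).smul (h.isBigO hc 0 hKO hK)).congr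
      (fun q => by simp [expansionError]) fun q => one_smul _ _
  | succ N ih =>
    have herr := (isBigO_refl (fun q : ℂ × ℝ × ℝ => q.1⁻¹) (nhdsInfty Γ K)).norm_right.smul
      ((h.isBigO hc N hKO hK).add (ih.const_smul_left α))
    refine herr.congr' ?_ (.of_forall fun q => ?_)
    · filter_upwards [eventually_nhdsInfty_ne Γ K 0, eventually_nhdsInfty_ne Γ K α] with q h0 hα
      exact (expansionError_div_sub N h0 hα).symm
    · simp [pow_succ', mul_comm]

end AsymptoticExpansion

section SimpleElement

open scoped Matrix.Norms.Operator

variable {n : ℕ} {α₁ α₂ l : ℂ} {σ : Mat n}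

theorem smul_simpleElement (α₂ : ℂ) (σ : Mat n) (h₁ : l ≠ α₁) :
    (l - α₁) • simpleElement α₁ α₂ σ l = l • 1 - spectralPencil α₁ α₂ σ := by
  rw [simpleElement, smul_add, smul_smul, mul_div_cancel₀ _ (sub_ne_zero.mpr h₁), spectralPencil]
  module

theorem simpleElement_mul_simpleElement (hσ : IsIdempotentElem σ) (h₁ : l ≠ α₁) (h₂ : l ≠ α₂) :
    simpleElement α₁ α₂ σ l * simpleElement α₂ α₁ σ l = 1 := by
  have h₁' := sub_ne_zero.mpr h₁
  have h₂' := sub_ne_zero.mpr h₂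
  simp only [simpleElement, add_mul, mul_add, one_mul, mul_one, smul_mul_smul_comm,
    hσ.one_sub.eq]
  match_scalars <;> field_simp <;> ring

theorem simpleElement_inv (hσ : IsIdempotentElem σ) (h₁ : l ≠ α₁) (h₂ : l ≠ α₂) :
    (simpleElement α₁ α₂ σ l)⁻¹ = simpleElement α₂ α₁ σ l :=
  Matrix.inv_eq_right_inv (simpleElement_mul_simpleElement hσ h₁ h₂)

theorem isUnit_simpleElement (hσ : IsIdempotentElem σ) (h₁ : l ≠ α₁) (h₂ : l ≠ α₂) :
    IsUnit (simpleElement α₁ α₂ σ l) :=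
  isUnit_iff_exists.mpr ⟨_, simpleElement_mul_simpleElement hσ h₁ h₂,
    simpleElement_mul_simpleElement hσ h₂ h₁⟩

theorem dressedMatrix_eq {E : ℂ → Mat n} {π : Mat n}
    (h : IsTransformedProj (E α₁) (E α₂) π σ) (h₁ : l ≠ α₁) (h₂ : l ≠ α₂) :
    dressedMatrix E α₁ α₂ π σ l
      = simpleElement α₁ α₂ π l * E l * (simpleElement α₁ α₂ σ l)⁻¹ := by
  have hmul := dressedMatrix_mul_sub h l
  rw [← smul_simpleElement _ _ h₁, ← smul_simpleElement _ _ h₁, mul_smul_comm, smul_mul_assoc]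
    at hmul
  rw [← smul_right_injective _ (sub_ne_zero.mpr h₁) hmul, simpleElement_inv h.idem h₁ h₂,
    mul_assoc, simpleElement_mul_simpleElement h.idem h₁ h₂, mul_one]

theorem contDiffOn_simpleElement {O : Set (ℝ × ℝ)} {Ω : Set ℂ} {σ : ℝ × ℝ → Mat n}
    (hσ : ContDiffOn ℝ ∞ σ O) (α₂ : ℂ) (h₁ : α₁ ∉ Ω) :
    ContDiffOn ℝ ∞ (fun q : (ℝ × ℝ) × ℂ => simpleElement α₁ α₂ (σ q.1) q.2) (O ×ˢ Ω) := by
  have hne (q : (ℝ × ℝ) × ℂ) (hq : q ∈ O ×ˢ Ω) : q.2 - α₁ ≠ 0 :=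
    sub_ne_zero.mpr fun h => h₁ (h ▸ hq.2)
  have hinv := ContDiffOn.inv (𝕜 := ℝ) (n := ∞) (contDiffOn_snd.sub contDiffOn_const) hne
  simp only [simpleElement, div_eq_mul_inv]
  exact contDiffOn_const.add ((contDiffOn_const.mul hinv).smul
    (contDiffOn_const.sub (hσ.comp contDiffOn_fst fun q hq => hq.1)))

theorem differentiableOn_simpleElement_apply {Ω : Set ℂ} (h₁ : α₁ ∉ Ω) (α₂ : ℂ) (σ : Mat n)
    (i k : Fin n) : DifferentiableOn ℂ (fun l => simpleElement α₁ α₂ σ l i k) Ω := by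
  have hne l (hl : l ∈ Ω) : l - α₁ ≠ 0 := sub_ne_zero.mpr fun h => h₁ (h ▸ hl)
  simp only [simpleElement, Matrix.add_apply, Matrix.smul_apply, smul_eq_mul]
  fun_prop (disch := assumption)

theorem meromorphicAt_simpleElement_apply (α₁ α₂ : ℂ) (σ : Mat n) (i k : Fin n) (l : ℂ) :
    MeromorphicAt (fun l => simpleElement α₁ α₂ σ l i k) l := by
  simp only [simpleElement, Matrix.add_apply, Matrix.smul_apply, smul_eq_mul]
  fun_prop

end SimpleElement

section WaveFunction

open Set Filter
open scoped Topology Matrix.Norms.Operator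

variable {n : ℕ} {O O₁ : Set (ℝ × ℝ)} {W S Γ : Set ℂ} {a : Fin n → ℂ} {p : Polynomial ℂ} {j : ℕ}
  {u : ℝ × ℝ → Mat n} {E E' m : ℝ × ℝ → ℂ → Mat n} {c : ℕ → ℝ × ℝ → Mat n} {α₁ α₂ : ℂ}
  {π : Mat n} {σ : ℝ × ℝ → Mat n}

/-- The transformed wave function `m h_{α₁,α₂,σ}⁻¹`. -/
noncomputable def dressedWave (m : ℝ × ℝ → ℂ → Mat n) (α₁ α₂ : ℂ) (σ : ℝ × ℝ → Mat n)
    (z : ℝ × ℝ) (l : ℂ) : Mat n :=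
  m z l * (simpleElement α₁ α₂ (σ z) l)⁻¹

theorem eventually_ne_nhdsNE {X : Type*} [TopologicalSpace X] [T1Space X] (x α : X) :
    ∀ᶠ l in 𝓝[≠] x, l ≠ α :=
  nhdsNE_le_cofinite x (Set.finite_singleton α).compl_mem_cofinite

theorem compl_union_pair_mem_codiscreteWithin {X : Set ℂ} (h : Sᶜ ∈ codiscreteWithin X)
    (α₁ α₂ : ℂ) : (S ∪ {α₁, α₂})ᶜ ∈ codiscreteWithin X := by
  rw [compl_union]
  exact inter_mem h (compl_finite_mem_codiscreteWithin (Set.toFinite {α₁, α₂}))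

theorem mem_diff_union_pair {X : Set ℂ} {l : ℂ} :
    l ∈ X \ (S ∪ {α₁, α₂}) ↔ l ∈ X \ S ∧ l ≠ α₁ ∧ l ≠ α₂ := by
  simp only [Set.mem_sdiff, mem_union, mem_insert_iff, mem_singleton_iff]
  tauto

theorem diff_union_pair_subset {X : Set ℂ} (α₁ α₂ : ℂ) : X \ (S ∪ {α₁, α₂}) ⊆ X \ S :=
  sdiff_subset_sdiff_right subset_union_left

theorem notMem_diff_union_pair_right (X S : Set ℂ) (α₁ α₂ : ℂ) : α₂ ∉ X \ (S ∪ {α₁, α₂}) :=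
  fun h => (mem_diff_union_pair.mp h).2.2 rfl

theorem dressedWave_eq {z : ℝ × ℝ} {l : ℂ} (hσ : IsIdempotentElem (σ z)) (h₁ : l ≠ α₁)
    (h₂ : l ≠ α₂) : dressedWave m α₁ α₂ σ z l = m z l * simpleElement α₂ α₁ (σ z) l := by
  rw [dressedWave, simpleElement_inv hσ h₁ h₂]

theorem HasExpansionAtInfty.mul_simpleElement_inv (h : HasExpansionAtInfty O Γ m c)
    (hc : ContinuousOn (c 0) O) (hσ : ContinuousOn σ O)
    (hidem : ∀ z ∈ O, IsIdempotentElem (σ z)) (α₁ α₂ : ℂ) :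
    HasExpansionAtInfty O Γ (dressedWave m α₁ α₂ σ)
      (fun r z => c r z + divCoeff c α₂ r z * ((α₂ - α₁) • (1 - σ z))) := by
  have hB : ContinuousOn (fun z => (α₂ - α₁) • (1 - σ z)) O :=
    by fun_prop
  refine (h.add ((h.div_sub hc α₂).mul_right hB)).congr fun K hKO => ?_
  filter_upwards [eventually_nhdsInfty_ne Γ K α₁, eventually_nhdsInfty_ne Γ K α₂,
    eventually_nhdsInfty_mem Γ K] with q h₁ h₂ hq
  rw [dressedWave_eq (hidem _ (hKO hq)) h₁ h₂, simpleElement, mul_add, mul_one, smul_mul_assoc,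
    mul_smul_comm, mul_smul_comm, smul_smul, inv_mul_eq_div]

theorem IsReducedWaveFunction.exists_expansion_dressedWave
    (hm : IsReducedWaveFunction a p j O₁ W S u E m) (hO : O ⊆ O₁) (hσ : ContDiffOn ℝ ∞ σ O)
    (hidem : ∀ z ∈ O, IsIdempotentElem (σ z)) (α₁ α₂ : ℂ) :
    ∃ c : ℕ → ℝ × ℝ → Mat n, (∀ r, SmoothOn (c r) O) ∧ (∀ z ∈ O, c 0 z = 1) ∧
      HasExpansionAtInfty O (scatteringRays a) (dressedWave m α₁ α₂ σ) c ∧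
      ∀ z ∈ O, dressedPotential a u α₁ α₂ σ z = ⁅Matrix.diagonal a, c 1 z⁆ := by
  obtain ⟨c, hc, hc0, hexp, hcu⟩ := hm.expansion
  have hcs r : ContDiffOn ℝ ∞ (c r) O := (smoothOn_iff.mp (hc r)).mono hO
  have hB : ContDiffOn ℝ ∞ (fun z => (α₂ - α₁) • (1 - σ z)) O :=
    (contDiffOn_const.sub hσ).const_smul _
  refine ⟨_, fun r => smoothOn_iff.mpr ((hcs r).add ((contDiffOn_divCoeff hcs α₂ r).mul hB)),
    fun z hz => ?_, (hexp.mono hO).mul_simpleElement_inv (hcs 0).continuousOn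
      hσ.continuousOn hidem α₁ α₂, fun z hz => ?_⟩
  · simp [divCoeff, hc0 z (hO hz)]
  · rw [dressedPotential, hcu z (hO hz)]
    simp only [divCoeff, hc0 z (hO hz), smul_zero, add_zero, one_mul, Ring.lie_def, mul_add,
      add_mul, mul_sub, sub_mul, mul_smul_comm, smul_mul_assoc, mul_one]
    module

theorem IsReducedWaveFunction.smoothOn_dressedWave
    (hm : IsReducedWaveFunction a p j O₁ W S u E m) (hO : O ⊆ O₁) (hσ : ContDiffOn ℝ ∞ σ O)
    (hidem : ∀ z ∈ O, IsIdempotentElem (σ z)) :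
    SmoothOn (fun q : (ℝ × ℝ) × ℂ => dressedWave m α₁ α₂ σ q.1 q.2)
      (O ×ˢ ((W \ scatteringRays a) \ (S ∪ {α₁, α₂}))) := by
  have hm' := (smoothOn_iff.mp hm.smooth).mono
    (prod_mono hO (diff_union_pair_subset α₁ α₂))
  refine smoothOn_iff.mpr ((hm'.mul (contDiffOn_simpleElement hσ α₁
    (notMem_diff_union_pair_right _ S α₁ α₂))).congr fun q hq => ?_)
  have hl := (mem_diff_union_pair.mp hq.2).2
  exact dressedWave_eq (hidem _ hq.1) hl.1 hl.2

theorem IsReducedWaveFunction.differentiableOn_dressedWave_apply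
    (hm : IsReducedWaveFunction a p j O W S u E m) {z : ℝ × ℝ} (hz : z ∈ O)
    (hidem : IsIdempotentElem (σ z)) (i k : Fin n) :
    DifferentiableOn ℂ (fun l => dressedWave m α₁ α₂ σ z l i k)
      ((W \ scatteringRays a) \ (S ∪ {α₁, α₂})) := by
  have hprod := DifferentiableOn.fun_sum (u := Finset.univ) fun x _ =>
    ((hm.holomorphic z hz i x).mono (diff_union_pair_subset α₁ α₂)).mul
      (differentiableOn_simpleElement_apply (notMem_diff_union_pair_right _ S α₁ α₂) α₁ (σ z) x k)
  refine hprod.congr fun l hl => ?_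
  have hl := (mem_diff_union_pair.mp hl).2
  rw [dressedWave_eq hidem hl.1 hl.2]
  rfl

theorem IsReducedWaveFunction.meromorphicOn_dressedWave_apply
    (hm : IsReducedWaveFunction a p j O W S u E m) {z : ℝ × ℝ} (hz : z ∈ O)
    (hidem : IsIdempotentElem (σ z)) (α₁ α₂ : ℂ) (i k : Fin n) :
    MeromorphicOn (fun l => dressedWave m α₁ α₂ σ z l i k) (W \ scatteringRays a) := by
  intro x hx
  have hprod := MeromorphicAt.fun_sum (s := Finset.univ) fun y _ =>
    (hm.meromorphic z hz i y x hx).mul (meromorphicAt_simpleElement_apply α₂ α₁ (σ z) y k x)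
  refine hprod.congr ?_
  filter_upwards [eventually_ne_nhdsNE x α₁, eventually_ne_nhdsNE x α₂] with l h₁ h₂
  rw [dressedWave_eq hidem h₁ h₂]
  rfl

theorem IsReducedWaveFunction.differentiable (hm : IsReducedWaveFunction a p j O W S u E m)
    {z : ℝ × ℝ} (hz : z ∈ O) : Differentiable ℂ (E z) :=
  differentiable_matrix_iff.mpr (hm.entire z hz)

theorem IsReducedWaveFunction.dressed (hm : IsReducedWaveFunction a p j O₁ W S u E m)
    (hO : O ⊆ O₁) (h0 : (0, 0) ∈ O) (hσ : ContDiffOn ℝ ∞ σ O)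
    (hidem : ∀ z ∈ O, IsIdempotentElem (σ z)) (hσ0 : σ (0, 0) = π)
    (hE' : ∀ z ∈ O, ∀ l, l ≠ α₁ → l ≠ α₂ → E' z l = simpleElement α₁ α₂ π l * E z l
      * (simpleElement α₁ α₂ (σ z) l)⁻¹)
    (hent : ∀ z ∈ O, Differentiable ℂ (E' z)) :
    IsReducedWaveFunction a p j O W (S ∪ {α₁, α₂}) (dressedPotential a u α₁ α₂ σ) E'
      (dressedWave m α₁ α₂ σ) where
  isOpen_domain := hm.isOpen_domain
  domain_nhds_infty := hm.domain_nhds_infty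
  exceptional_bounded := hm.exceptional_bounded.union (Set.toFinite {α₁, α₂}).isBounded
  exceptional_discrete := compl_union_pair_mem_codiscreteWithin hm.exceptional_discrete α₁ α₂
  smooth := hm.smoothOn_dressedWave hO hσ hidem
  invertible z hz l hl := by
    obtain ⟨hl, h₁, h₂⟩ := mem_diff_union_pair.mp hl
    rw [dressedWave_eq (hidem z hz) h₁ h₂]
    exact (hm.invertible z (hO hz) l hl).mul (isUnit_simpleElement (hidem z hz) h₂ h₁)
  holomorphic z hz := hm.differentiableOn_dressedWave_apply (hO hz) (hidem z hz)
  meromorphic z hz := hm.meromorphicOn_dressedWave_apply (hO hz) (hidem z hz) α₁ α₂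
  expansion := hm.exists_expansion_dressedWave hO hσ hidem α₁ α₂
  entire z hz := differentiable_matrix_iff.mp (hent z hz)
  wave_eq z hz l hl := by
    obtain ⟨hl, h₁, h₂⟩ := mem_diff_union_pair.mp hl
    have hπ : IsUnit (simpleElement α₁ α₂ π l).det :=
      (Matrix.isUnit_iff_isUnit_det _).mp (isUnit_simpleElement (hσ0 ▸ hidem _ h0) h₁ h₂)
    rw [hE' z hz l h₁ h₂, hm.wave_eq z (hO hz) l hl, dressedWave, dressedWave, hσ0,
      Matrix.mul_inv_rev, Matrix.nonsing_inv_nonsing_inv _ hπ]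
    simp only [mul_assoc]

end WaveFunction

open scoped Matrix.Norms.Operator in
theorem theorem4p3_general {n : ℕ} (a : Fin n → ℂ) (p : Polynomial ℂ) (j : ℕ)
    (O₁ : Set (ℝ × ℝ)) (hO₁ : IsOpen O₁) (h0 : ((0, 0) : ℝ × ℝ) ∈ O₁)
    (u : ℝ × ℝ → Mat n) (hu : IsLocalSolution a p j O₁ u)
    (E : ℝ × ℝ → ℂ → Mat n) (hE : IsTrivialization a p j O₁ u E)
    (W S : Set ℂ) (m : ℝ × ℝ → ℂ → Mat n) (hm : IsReducedWaveFunction a p j O₁ W S u E m)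
    (α₁ α₂ : ℂ) (π : Mat n) (hπ : π * π = π) :
    (∃ O : Set (ℝ × ℝ), IsOpen O ∧ IsConnected O ∧ (0, 0) ∈ O ∧ O ⊆ O₁ ∧
      ∀ z ∈ O, pullbackRange (E z α₁) π ⊓ pullbackRange (E z α₂) (1 - π) = ⊥) ∧
    ∀ O : Set (ℝ × ℝ), IsOpen O → (0, 0) ∈ O → O ⊆ O₁ →
      (∀ z ∈ O, pullbackRange (E z α₁) π ⊓ pullbackRange (E z α₂) (1 - π) = ⊥) →
      (∀ z ∈ O, IsCompl (pullbackRange (E z α₁) π) (pullbackRange (E z α₂) (1 - π))) ∧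
      IsLocalSolution a p j O
        (fun z => u z + (α₁ - α₂) • ⁅Matrix.diagonal a, dressedProj E α₁ α₂ π z⁆) ∧
      (∃ E' : ℝ × ℝ → ℂ → Mat n,
        (∀ z ∈ O, ∀ l, l ≠ α₁ → l ≠ α₂ →
          E' z l = simpleElement α₁ α₂ π l * E z l
            * (simpleElement α₁ α₂ (dressedProj E α₁ α₂ π z) l)⁻¹) ∧
        IsTrivialization a p j O
          (fun z => u z + (α₁ - α₂) • ⁅Matrix.diagonal a, dressedProj E α₁ α₂ π z⁆) E' ∧
        IsReducedWaveFunction a p j O W (S ∪ {α₁, α₂})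
          (fun z => u z + (α₁ - α₂) • ⁅Matrix.diagonal a, dressedProj E α₁ α₂ π z⁆) E'
          (fun z l => m z l * (simpleElement α₁ α₂ (dressedProj E α₁ α₂ π z) l)⁻¹)) ∧
      SmoothOn (dressedProj E α₁ α₂ π) O ∧
      SolvesProjSystem a p j O u α₁ α₂ π (dressedProj E α₁ α₂ π) ∧
      (IsPreconnected O → ∀ σ : ℝ × ℝ → Mat n,
        SolvesProjSystem a p j O u α₁ α₂ π σ → Set.EqOn σ (dressedProj E α₁ α₂ π) O) := by
  refine ⟨hE.exists_isConnected_inf_eq_bot hO₁ h0 hπ, fun O hO h0' hsub hd => ?_⟩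
  have hEO := hE.mono hsub
  have huO := (smoothOn_iff.mp hu.smooth).mono hsub
  have hproj z (hz : z ∈ O) := isTransformedProj_dressedProj hπ (hd z hz)
  have hidem z (hz : z ∈ O) := (hproj z hz).idem
  have hσs := hEO.contDiffOn_dressedProj hπ hd
  have hσ := hEO.solvesProjSystem_dressedProj hO h0' hπ hd
  have hentire z (hz : z ∈ O) := hm.differentiable (hsub hz)
  have hE' z (hz : z ∈ O) l (h₁ : l ≠ α₁) (h₂ : l ≠ α₂) :=
    dressedMatrix_eq (hproj z hz) h₁ h₂
  have htriv := hEO.dressed hO huO hentire hπ hproj hσs hσ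
  have hflow := htriv.isLocalSolution hO (contDiffOn_dressedPotential a huO hσs α₁ α₂)
    fun z hz => add_smul_mem_slPerp (hu.mem_perp z (hsub hz)) (lie_diagonal_mem_slPerp a _) _
  have hwave := hm.dressed hsub h0' hσs hidem hσ.initial hE'
    fun z hz => differentiable_dressedMatrix (hentire z hz) α₁ α₂ π _
  exact ⟨fun z hz => (hproj z hz).isCompl_pullbackRange hπ, hflow, ⟨_, hE', htriv, hwave⟩,
    smoothOn_iff.mpr hσs, hσ, fun hc ρ hρ => hρ.eqOn_dressedProj huO hEO hO hc h0' hπ hd⟩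

theorem theorem4p3 {n : ℕ} (a : Fin n → ℂ) (ha : a ≠ 0) (ha_tr : ∑ i, a i = 0)
    (p : Polynomial ℂ) (j : ℕ) (hj : 0 < j)
    (O₁ : Set (ℝ × ℝ)) (hO₁ : IsOpen O₁) (h0 : ((0, 0) : ℝ × ℝ) ∈ O₁)
    (u : ℝ × ℝ → Mat n) (hu : IsLocalSolution a p j O₁ u)
    (E : ℝ × ℝ → ℂ → Mat n) (hE : IsTrivialization a p j O₁ u E)
    (W S : Set ℂ) (m : ℝ × ℝ → ℂ → Mat n) (hm : IsReducedWaveFunction a p j O₁ W S u E m)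
    (α₁ α₂ : ℂ) (π : Mat n) (hπ : π * π = π) :
    (∃ O : Set (ℝ × ℝ), IsOpen O ∧ IsConnected O ∧ (0, 0) ∈ O ∧ O ⊆ O₁ ∧
      ∀ z ∈ O, pullbackRange (E z α₁) π ⊓ pullbackRange (E z α₂) (1 - π) = ⊥) ∧
    ∀ O : Set (ℝ × ℝ), IsOpen O → (0, 0) ∈ O → O ⊆ O₁ →
      (∀ z ∈ O, pullbackRange (E z α₁) π ⊓ pullbackRange (E z α₂) (1 - π) = ⊥) →
      (∀ z ∈ O, IsCompl (pullbackRange (E z α₁) π) (pullbackRange (E z α₂) (1 - π))) ∧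
      IsLocalSolution a p j O
        (fun z => u z + (α₁ - α₂) • ⁅Matrix.diagonal a, dressedProj E α₁ α₂ π z⁆) ∧
      (∃ E' : ℝ × ℝ → ℂ → Mat n,
        (∀ z ∈ O, ∀ l, l ≠ α₁ → l ≠ α₂ →
          E' z l = simpleElement α₁ α₂ π l * E z l
            * (simpleElement α₁ α₂ (dressedProj E α₁ α₂ π z) l)⁻¹) ∧
        IsTrivialization a p j O
          (fun z => u z + (α₁ - α₂) • ⁅Matrix.diagonal a, dressedProj E α₁ α₂ π z⁆) E' ∧
        IsReducedWaveFunction a p j O W (S ∪ {α₁, α₂})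
          (fun z => u z + (α₁ - α₂) • ⁅Matrix.diagonal a, dressedProj E α₁ α₂ π z⁆) E'
          (fun z l => m z l * (simpleElement α₁ α₂ (dressedProj E α₁ α₂ π z) l)⁻¹)) ∧
      SmoothOn (dressedProj E α₁ α₂ π) O ∧
      SolvesProjSystem a p j O u α₁ α₂ π (dressedProj E α₁ α₂ π) ∧
      (IsPreconnected O → ∀ σ : ℝ × ℝ → Mat n,
        SolvesProjSystem a p j O u α₁ α₂ π σ → Set.EqOn σ (dressedProj E α₁ α₂ π) O) :=
  theorem4p3_general a p j O₁ hO₁ h0 u hu E hE W S m hm α₁ α₂ π hπ
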